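/- **Setting.** Let $\mathcal X$ be a finite set of outcomes, let $\theta_1,\dots,\theta_N$ ($N\ge 2$) be probability distributions on $\mathcal X$ (the policies; together they form $\Theta$), and let $T\ge 1$. A sequence of random loss vectors $\ell_1,\dots,\ell_T\in[0,1]^{\mathcal X}$ with arbitrary joint law is drawn at the beginning. At each round $t$ the learner draws a policy $\vartheta_t$, then an outcome $X_t\sim\vartheta_t$ is drawn and the learner observes $X_t$ and $\ell_t(X_t)$. Write $\ell_t(\theta)=\sum_x\theta(x)\ell_t(x)$, let $\mathcal F_t$ be the $\sigma$-algebra generated by $(\vartheta_s,X_s,\ell_s(X_s))_{s\le t}$, and let the regret be $$R_T=\mathbb E\Big[\sum_{t=1}^T\ell_t(\vartheta_t)\Big]-\min_{\theta\in\Theta}\mathbb E\Big[\sum_{t=1}^T\ell_t(\theta)\Big].$$ The capacity of the policy set is $$C(\Theta)=\sup_{\tau}\sum_{\theta}\tau(\theta)\,\chi^2\Big(\theta\,\Big\|\,\sum_{\theta'}\tau(\theta')\theta'\Big),\qquad \chi^2(P\|Q)=\sum_x Q(x)\Big(\frac{P(x)}{Q(x)}-1\Big)^2,$$ the supremum being over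 all probability distributions $\tau$ on the policies. **Algorithm (EXP4 with entropy-adaptive learning rate).** With $\hat\ell_s(\theta)=\dfrac{\theta(X_s)}{\sum_{\theta'}p_s(\theta')\theta'(X_s)}\,\ell_s(X_s)$, at round $t$ the policy $\vartheta_t$ is drawn, conditionally on the past and on the whole loss sequence, from $$p_t(\theta)=\frac{\exp\big(-\eta_t\sum_{s<t}\hat\ell_s(\theta)\big)}{\sum_{\theta'}\exp\big(-\eta_t\sum_{s<t}\hat\ell_s(\theta')\big)},\qquad \eta_t=\min\Big\{1,\frac1{\beta_t}\Big\}\quad(\eta_t=1\text{ if }\beta_t=0),$$ where, with $\gamma=\sqrt{\dfrac{e\,C(\Theta)\log(eT)}{2\log N}}$ and $H(p)=\sum_\theta p(\theta)\log(1/p(\theta))$, $$\beta_1=\gamma,\qquad \beta_{t+1}=\beta_t+\frac{\gamma}{\sqrt{1+\frac1{\log N}\sum_{s=1}^tH(p_s)}}.$$ **Theorem.** In general, $$R_T\le 3\sqrt{2e\,C(\Theta)\,T\log(eT)\log(eN)}+\log N.$$ Moreover, suppose that the environment is in the adversarially corrupted stochastic regime: there are a policy $\theta^\circ\in\Theta$,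 a gap $\Delta\in(0,1]$ and corruption levels $c_1,\dots,c_T\ge 0$ such that for every round $t$ and every policy $\theta\ne\theta^\circ$, almost surely, $\mathbb E[\ell_t(\theta)-\ell_t(\theta^\circ)\mid\mathcal F_{t-1}]\ge\Delta-c_t$. Then, with $C=\sum_{t=1}^Tc_t$, the same algorithm also satisfies $$R_T\le 36e^2\,\frac{C(\Theta)\log(eT)\log(NT)}{\Delta}+3e\sqrt{\frac{2\,C(\Theta)\log(eT)\log(NT)\,C}{\Delta}}+2\log N+4\Delta.$$ -/

import Mathlib

open MeasureTheory

/-! ### Policies, chi-squared information, capacity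

There are `N` policies and `K` outcomes. A policy set is a family `θ : Fin N → Fin K → ℝ` of
probability vectors: `θ i x` is the probability that policy `i` gives to outcome `x`. -/

/-- The outcome distribution `∑ i, τ i • θ i` induced by a distribution `τ` over the policies. -/
noncomputable def mixture {N K : ℕ} (θ : Fin N → Fin K → ℝ) (τ : Fin N → ℝ) (x : Fin K) : ℝ :=
  ∑ i, τ i * θ i x

/-- The chi-squared divergence `χ²(P ‖ Q) = ∑ x, Q x * (P x / Q x - 1) ^ 2`, for `P` absolutely
continuous with respect to `Q` (terms with `P x = Q x = 0` vanish). -/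
noncomputable def chiSqDiv {K : ℕ} (P Q : Fin K → ℝ) : ℝ :=
  ∑ x, Q x * (P x / Q x - 1) ^ 2

/-- The mutual chi-squared information `Q_τ(Θ)` between a policy drawn from `τ` and an outcome
drawn from that policy. The divergence of `θ i` only matters when `τ i ≠ 0`, and then `θ i` is
absolutely continuous with respect to the mixture, see `mixture_ne_zero`. -/
noncomputable def chiSqInfo {N K : ℕ} (θ : Fin N → Fin K → ℝ) (τ : Fin N → ℝ) : ℝ :=
  ∑ i, τ i * chiSqDiv (θ i) (mixture θ τ)

/-- The chi-squared capacity of the policy set: the supremum of the mutual chi-squared information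
over all distributions over the policies. The supremum is over a nonempty set (for `N ≠ 0`)
that is bounded above, see `bddAbove_chiSqInfo`. -/
noncomputable def capacity {N K : ℕ} (θ : Fin N → Fin K → ℝ) : ℝ :=
  sSup (chiSqInfo θ '' stdSimplex ℝ (Fin N))

theorem le_mixture {N K : ℕ} {θ : Fin N → Fin K → ℝ} {τ : Fin N → ℝ}
    (hθ : ∀ i, θ i ∈ stdSimplex ℝ (Fin K)) (hτ : τ ∈ stdSimplex ℝ (Fin N))
    (i : Fin N) (x : Fin K) : τ i * θ i x ≤ mixture θ τ x :=
  Finset.single_le_sum (f := fun j => τ j * θ j x)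
    (fun j _ => mul_nonneg (hτ.1 j) ((hθ j).1 x)) (Finset.mem_univ i)

theorem mixture_ne_zero {N K : ℕ} {θ : Fin N → Fin K → ℝ} {τ : Fin N → ℝ}
    (hθ : ∀ i, θ i ∈ stdSimplex ℝ (Fin K)) (hτ : τ ∈ stdSimplex ℝ (Fin N))
    {i : Fin N} {x : Fin K} (hi : τ i ≠ 0) (hx : θ i x ≠ 0) : mixture θ τ x ≠ 0 := by
  have h1 : 0 < τ i * θ i x :=
    mul_pos (lt_of_le_of_ne (hτ.1 i) hi.symm) (lt_of_le_of_ne ((hθ i).1 x) hx.symm)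
  exact (h1.trans_le (le_mixture hθ hτ i x)).ne'

theorem bddAbove_chiSqInfo {N K : ℕ} {θ : Fin N → Fin K → ℝ}
    (hθ : ∀ i, θ i ∈ stdSimplex ℝ (Fin K)) :
    BddAbove (chiSqInfo θ '' stdSimplex ℝ (Fin N)) := by
  refine ⟨∑ i : Fin N, ∑ x : Fin K, (θ i x + 1), ?_⟩
  rintro _ ⟨τ, hτ, rfl⟩
  refine Finset.sum_le_sum fun i _ => ?_
  rw [chiSqDiv, Finset.mul_sum]
  refine Finset.sum_le_sum fun x _ => ?_
  have h0 := hτ.1 i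
  have hx := (hθ i).1 x
  have hle := le_mixture hθ hτ i x
  have hm1 : mixture θ τ x ≤ 1 := by
    rw [← hτ.2]
    refine Finset.sum_le_sum fun j _ => ?_
    have h1 : θ j x ≤ 1 := by
      rw [← (hθ j).2]
      exact Finset.single_le_sum (fun y _ => (hθ j).1 y) (Finset.mem_univ x)
    exact mul_le_of_le_one_right (hτ.1 j) h1
  have ht1 : τ i ≤ 1 := by
    rw [← hτ.2]
    exact Finset.single_le_sum (fun y _ => hτ.1 y) (Finset.mem_univ i)
  rcases (mul_nonneg h0 hx |>.trans hle).eq_or_lt with hm | hm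
  · rw [← hm]
    simp only [zero_mul, mul_zero]
    linarith
  · set m := mixture θ τ x
    have e : τ i * (m * (θ i x / m - 1) ^ 2)
        = (τ i * θ i x) / m * θ i x - 2 * (τ i * θ i x) + τ i * m := by
      field_simp
      ring
    rw [e]
    have h2 : (τ i * θ i x) / m ≤ 1 := (div_le_one hm).2 hle
    have h3 : (τ i * θ i x) / m * θ i x ≤ θ i x := mul_le_of_le_one_left hx h2
    have h4 : τ i * m ≤ 1 := mul_le_one₀ ht1 hm.le hm1
    nlinarith [mul_nonneg h0 hx]

/-! ### The algorithm

Rounds are numbered `0, …, T - 1`; "at round `t`" means after `t` completed rounds. -/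

/-- The Shannon entropy of a distribution over the policies. -/
noncomputable def shannonEntropy {N : ℕ} (p : Fin N → ℝ) : ℝ :=
  ∑ i, p i * Real.log (1 / p i)

/-- The quantities that the algorithm maintains: the cumulative estimated loss of every policy,
the current inverse learning-rate parameter `β`, and the sum of the entropies of the policy
distributions used so far. -/
structure Exp4State (N : ℕ) where
  cumLoss : Fin N → ℝ
  β : ℝ
  cumEntropy : ℝ

/-- The learning rate `min {1, 1 / β}`, written so that it equals `1` for `β = 0`. -/
noncomputable def Exp4State.rate {N : ℕ} (s : Exp4State N) : ℝ :=
  1 / max 1 s.β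

/-- The exponential-weights distribution over the policies in a given state. -/
noncomputable def Exp4State.prob {N : ℕ} (s : Exp4State N) (i : Fin N) : ℝ :=
  Real.exp (-(s.rate * s.cumLoss i)) / ∑ j, Real.exp (-(s.rate * s.cumLoss j))

/-- The state before any round has been played: zero cumulative losses and `β = γ`. -/
noncomputable def Exp4State.init (N : ℕ) (γ : ℝ) : Exp4State N where
  cumLoss := fun _ => 0
  β := γ
  cumEntropy := 0

/-- The update after a round in which outcome `x` was drawn and the loss `y` was observed:
importance-weighted loss estimates are added, and `β` grows by
`γ / √(1 + (sum of the entropies, this round included) / log N)`. -/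
noncomputable def Exp4State.update {N K : ℕ} (θ : Fin N → Fin K → ℝ) (γ : ℝ)
    (s : Exp4State N) (x : Fin K) (y : ℝ) : Exp4State N where
  cumLoss := fun i => s.cumLoss i + θ i x / mixture θ s.prob x * y
  β := s.β + γ / √(1 + 1 / Real.log N * (s.cumEntropy + shannonEntropy s.prob))
  cumEntropy := s.cumEntropy + shannonEntropy s.prob

/-- The state after `t` rounds, given the sequence of observed pairs (outcome, loss). -/
noncomputable def exp4State {N K : ℕ} (θ : Fin N → Fin K → ℝ) (γ : ℝ)
    (obs : ℕ → Fin K × ℝ) : ℕ → Exp4State N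
  | 0 => Exp4State.init N γ
  | t + 1 => (exp4State θ γ obs t).update θ γ (obs t).1 (obs t).2

/-- The parameter `γ = √(e C(Θ) log(eT) / (2 log N))` of the learning-rate schedule. -/
noncomputable def exp4Gamma {N K : ℕ} (θ : Fin N → Fin K → ℝ) (T : ℕ) : ℝ :=
  √(Real.exp 1 * capacity θ * Real.log (Real.exp 1 * T) / (2 * Real.log N))

/-! ### The game

On a probability space `Ω`, `ℓ t ω x` is the loss of outcome `x` at round `t`, `ϑ t ω` the policy
selected and `O t ω` the outcome drawn. -/

/-- The expected loss `ℓ_t(θ) = ∑ x, θ x * ℓ_t x` of policy `i` under the loss vector `l`. -/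
noncomputable def policyLoss {N K : ℕ} (θ : Fin N → Fin K → ℝ) (l : Fin K → ℝ) (i : Fin N) : ℝ :=
  ∑ x, θ i x * l x

/-- The sigma-algebra of the interaction history before round `t`, generated by the selected
policies, the outcomes and the observed losses of the rounds `s < t`. -/
abbrev historySigma {Ω : Type*} {N K : ℕ} (ℓ : ℕ → Ω → Fin K → ℝ)
    (ϑ : ℕ → Ω → Fin N) (O : ℕ → Ω → Fin K) (t : ℕ) : MeasurableSpace Ω :=
  ⨆ s : ℕ, ⨆ _ : s < t,
    MeasurableSpace.comap (fun ω => (ϑ s ω, O s ω, ℓ s ω (O s ω))) inferInstance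

/-- The sigma-algebra of the whole latent sequence of losses of the `T` rounds. -/
abbrev lossSigma {Ω : Type*} {K : ℕ} (ℓ : ℕ → Ω → Fin K → ℝ) (T : ℕ) : MeasurableSpace Ω :=
  ⨆ s : ℕ, ⨆ _ : s < T, MeasurableSpace.comap (ℓ s) inferInstance

/-- The distribution over the policies that the algorithm uses at round `t`. -/
noncomputable def exp4Prob {Ω : Type*} {N K : ℕ} (θ : Fin N → Fin K → ℝ) (γ : ℝ)
    (ℓ : ℕ → Ω → Fin K → ℝ) (O : ℕ → Ω → Fin K) (t : ℕ) (ω : Ω) : Fin N → ℝ :=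
  (exp4State θ γ (fun s => (O s ω, ℓ s ω (O s ω))) t).prob

/-- `(ℓ, ϑ, O)` is a run of the algorithm for `T` rounds: the losses are random vectors in
`[0, 1]^K` drawn at the beginning of the game with an arbitrary joint law, and at each round,
given the whole loss sequence and the history, the policy is drawn from the algorithm's
distribution and then the outcome is drawn from the selected policy. -/
structure IsExp4Run {Ω : Type*} [MeasurableSpace Ω] (μ : Measure Ω) {N K : ℕ}
    (θ : Fin N → Fin K → ℝ) (γ : ℝ) (T : ℕ) (ℓ : ℕ → Ω → Fin K → ℝ)
    (ϑ : ℕ → Ω → Fin N) (O : ℕ → Ω → Fin K) : Prop where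
  measurable_loss : ∀ t < T, Measurable (ℓ t)
  measurable_policy : ∀ t < T, Measurable (ϑ t)
  measurable_outcome : ∀ t < T, Measurable (O t)
  loss_mem : ∀ t < T, ∀ ω x, ℓ t ω x ∈ Set.Icc (0 : ℝ) 1
  cond_law : ∀ t < T, ∀ (i : Fin N) (x : Fin K),
    μ[Set.indicator {ω | ϑ t ω = i ∧ O t ω = x} (fun _ => (1 : ℝ)) |
      lossSigma ℓ T ⊔ historySigma ℓ ϑ O t] =ᵐ[μ]
        fun ω => exp4Prob θ γ ℓ O t ω i * θ i x

/-- The regret: the expected total loss of the selected policies minus the smallest expected total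
loss of a fixed policy. -/
noncomputable def regret {Ω : Type*} [MeasurableSpace Ω] (μ : Measure Ω) {N K : ℕ}
    (θ : Fin N → Fin K → ℝ) (T : ℕ) (ℓ : ℕ → Ω → Fin K → ℝ) (ϑ : ℕ → Ω → Fin N) : ℝ :=
  (∫ ω, ∑ t ∈ Finset.range T, policyLoss θ (ℓ t ω) (ϑ t ω) ∂μ)
    - ⨅ i : Fin N, ∫ ω, ∑ t ∈ Finset.range T, policyLoss θ (ℓ t ω) i ∂μ

/-- The adversarially corrupted stochastic regime with optimal policy `iStar`, gap `Δ` and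
corruption level `c t` at round `t`: given the history, every other policy is at each round
expected to be worse than `iStar` by at least `Δ - c t`. -/
structure IsCorruptedStochastic {Ω : Type*} [MeasurableSpace Ω] (μ : Measure Ω) {N K : ℕ}
    (θ : Fin N → Fin K → ℝ) (T : ℕ) (ℓ : ℕ → Ω → Fin K → ℝ)
    (ϑ : ℕ → Ω → Fin N) (O : ℕ → Ω → Fin K) (iStar : Fin N) (Δ : ℝ) (c : ℕ → ℝ) : Prop where
  gap_pos : 0 < Δ
  gap_le_one : Δ ≤ 1
  corruption_nonneg : ∀ t < T, 0 ≤ c t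
  gap : ∀ t < T, ∀ i : Fin N, i ≠ iStar →
    ∀ᵐ ω ∂μ, Δ - c t ≤
      (μ[fun ω' => policyLoss θ (ℓ t ω') i - policyLoss θ (ℓ t ω') iStar |
        historySigma ℓ ϑ O t]) ω

/-! ### Entropy and exponential weights -/

/-! The potential is the unnormalised soft minimum `softMin b L = -b log ∑ exp (-L / b)` with `b =
max 1 β`, the inverse learning rate. By Gibbs' variational principle it is the minimum over `q` of
`⟨q, L⟩ - b H(q)`, and the algorithm's distribution is the minimiser. Hence raising `b` between
rounds costs the increment times the entropy of the new distribution (`softMin_rate_change`), while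
adding the estimates `g` raises the potential by at least `⟨p, g⟩` minus a second-order term
(`le_softMin_add`). That term may be centred at any `y` with `g - y ≥ -1`. Centring at the observed
loss turns the second moment into a chi-squared divergence, so its conditional mean is at most the
capacity.

Put `A = (∑ H(p_s)) / log N`. The increments of `β` are at most `γ / √(1 + A)` at the current `A`,
so the rate-change cost telescopes to `2 γ log N (√A - 1)`. They are also at least `γ / √(1 + A)` at
the final `A`, so `β` grows linearly, the learning rates sum like a harmonic series, and the choice
of `γ` makes the stability cost at most `γ log N √(1 + A)`. Together this is `log N + 3 γ log N √A`
on every trajectory (`penalty_add_stability_le`). Unbiasedness of the estimates and Jensen's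
inequality give regret at most `log N + 3 √(e/2 · C(Θ) · log(eT) · E ∑ H(p_s))`
(`sum_integral_policyLoss_sub_le`).

The general bound follows from `H ≤ log N`. In the corrupted stochastic regime, `H(p) ≤ 1/T +
log(NT) (1 - p(θ°))` (`shannonEntropy_le_of_mass`), while the regret is at least `Δ ∑ E(1 - p_t(θ°))
- C` (`gap_mul_sum_sub_le`). So the regret is bounded by the square root of an affine function of
itself, and `regret_le_of_self_bounding` solves this inequality. -/

theorem Real.exp_le_one_add_add_exp_one_half_mul_sq {x : ℝ} (hx : x ≤ 1) :
    Real.exp x ≤ 1 + x + Real.exp 1 / 2 * x ^ 2 := by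
  have he : (1 : ℝ) ≤ Real.exp 1 / 2 := by
    have := Real.add_one_le_exp (1 : ℝ)
    linarith
  have h2 : x ^ 2 ≤ Real.exp 1 / 2 * x ^ 2 := le_mul_of_one_le_left (sq_nonneg x) he
  rcases le_or_gt (-1) x with h | h
  · have := (abs_le.1 (Real.abs_exp_sub_one_sub_id_le (abs_le.2 ⟨h, hx⟩))).2
    linarith
  -- For `x < -1` the left side is at most `1`, while `x + x ^ 2` is positive.
  · have := Real.exp_le_one_iff.2 (show x ≤ 0 by linarith)
    nlinarith

/-- The right side is `2h / (√(S + h) + √S)`, and `h ≤ 1` puts both roots below `√(1 + S)`. The `1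
+` in the learning-rate schedule thus stands in for the next normalised entropy, unknown when `β` is
updated. -/
theorem div_sqrt_one_add_le {S h : ℝ} (hS : 0 ≤ S) (h0 : 0 ≤ h) (h1 : h ≤ 1) :
    h / √(1 + S) ≤ 2 * (√(S + h) - √S) := by
  have ha : 0 < √(1 + S) := Real.sqrt_pos.2 (by linarith)
  have hb : √(S + h) ≤ √(1 + S) := Real.sqrt_le_sqrt (by linarith)
  have hc : √S ≤ √(S + h) := Real.sqrt_le_sqrt (by linarith)
  have hd : √(S + h) ^ 2 = S + h := Real.sq_sqrt (by linarith)
  have he : √S ^ 2 = S := Real.sq_sqrt hS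
  rw [div_le_iff₀ ha]
  nlinarith [Real.sqrt_nonneg S, mul_nonneg (sub_nonneg.2 hc) (sub_nonneg.2 hb),
    mul_nonneg (sub_nonneg.2 hc) (sub_nonneg.2 (hc.trans hb))]

/-- The Gibbs variational inequality. -/
theorem shannonEntropy_le_add_log_sum_exp {N : ℕ} [NeZero N] {q : Fin N → ℝ}
    (hq : q ∈ stdSimplex ℝ (Fin N)) (L : Fin N → ℝ) :
    shannonEntropy q ≤ ∑ i, q i * L i + Real.log (∑ i, Real.exp (-L i)) := by
  set Z := ∑ i, Real.exp (-L i)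
  have hZ : 0 < Z := Finset.sum_pos (fun _ _ => Real.exp_pos _) Finset.univ_nonempty
  -- Nonnegativity of the relative entropy to the Gibbs weights `exp (-L i) / Z`, termwise from `log
  -- u ≤ u - 1`; the right sides sum to zero.
  have key : ∀ i, q i * Real.log (1 / q i) - q i * L i - q i * Real.log Z
      ≤ Real.exp (-L i) / Z - q i := by
    intro i
    have hw : 0 < Real.exp (-L i) / Z := div_pos (Real.exp_pos _) hZ
    rcases (hq.1 i).eq_or_lt with h | h
    · rw [← h]; simpa using hw.le
    · have h1 := Real.log_le_sub_one_of_pos (div_pos hw h)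
      have h2 : Real.log (Real.exp (-L i) / Z / q i)
          = Real.log (1 / q i) - L i - Real.log Z := by
        rw [Real.log_div hw.ne' h.ne', Real.log_div (Real.exp_pos _).ne' hZ.ne', Real.log_exp,
          one_div, Real.log_inv]
        ring
      rw [h2] at h1
      have h3 := mul_le_mul_of_nonneg_left h1 h.le
      have h4 : q i * (Real.exp (-L i) / Z / q i - 1) = Real.exp (-L i) / Z - q i := by
        field_simp
      linarith
  have := Finset.sum_le_sum fun i (_ : i ∈ Finset.univ) => key i
  simp only [Finset.sum_sub_distrib, ← Finset.sum_mul, ← Finset.sum_div, hq.2] at this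
  rw [div_self hZ.ne'] at this
  unfold shannonEntropy
  linarith

theorem shannonEntropy_nonneg {N : ℕ} {q : Fin N → ℝ} (hq : q ∈ stdSimplex ℝ (Fin N)) :
    0 ≤ shannonEntropy q := by
  refine Finset.sum_nonneg fun i _ => ?_
  have h1 : q i ≤ 1 := by
    rw [← hq.2]
    exact Finset.single_le_sum (fun y _ => hq.1 y) (Finset.mem_univ i)
  rw [one_div, Real.log_inv]
  exact mul_nonneg (hq.1 i) (neg_nonneg.2 (Real.log_nonpos (hq.1 i) h1))

theorem shannonEntropy_le_log {N : ℕ} [NeZero N] {q : Fin N → ℝ}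
    (hq : q ∈ stdSimplex ℝ (Fin N)) : shannonEntropy q ≤ Real.log N := by
  simpa using shannonEntropy_le_add_log_sum_exp hq (fun _ => 0)

/-- Gibbs' inequality with energy `0` at `k` and `a` elsewhere, then `log (1 + u) ≤ u`. With `a =
log (N T)` the first term is `1 / T`, so over `T` rounds it costs only `1`. -/
theorem shannonEntropy_le_of_mass {N : ℕ} [NeZero N] {q : Fin N → ℝ}
    (hq : q ∈ stdSimplex ℝ (Fin N)) (k : Fin N) (a : ℝ) :
    shannonEntropy q ≤ N * Real.exp (-a) + a * (1 - q k) := by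
  have h := shannonEntropy_le_add_log_sum_exp hq (fun i => if i = k then 0 else a)
  have h1 : ∑ i, q i * (if i = k then 0 else a) = a * (1 - q k) := by
    have : ∀ i, q i * (if i = k then 0 else a) = a * q i - if i = k then a * q i else 0 := by
      intro i; split_ifs <;> ring
    simp only [this, Finset.sum_sub_distrib, ← Finset.mul_sum, hq.2, Finset.sum_ite_eq',
      Finset.mem_univ, if_true]
    ring
  have h2 : ∑ i, Real.exp (-(if i = k then 0 else a)) ≤ 1 + N * Real.exp (-a) := by
    have : ∀ i, Real.exp (-(if i = k then 0 else a))
        ≤ (if i = k then 1 else 0) + Real.exp (-a) := by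
      intro i
      have := Real.exp_pos (-a)
      split_ifs <;> simp [this.le]
    refine (Finset.sum_le_sum fun i _ => this i).trans ?_
    simp [Finset.sum_add_distrib]
  have h3 : 0 < ∑ i, Real.exp (-(if i = k then 0 else a)) :=
    Finset.sum_pos (fun _ _ => Real.exp_pos _) Finset.univ_nonempty
  have h4 := Real.log_le_sub_one_of_pos h3
  linarith

theorem Exp4State.sum_exp_pos {N : ℕ} [NeZero N] (s : Exp4State N) :
    0 < ∑ j, Real.exp (-(s.rate * s.cumLoss j)) :=
  Finset.sum_pos (fun _ _ => Real.exp_pos _) Finset.univ_nonempty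

theorem Exp4State.prob_pos {N : ℕ} [NeZero N] (s : Exp4State N) (i : Fin N) : 0 < s.prob i :=
  div_pos (Real.exp_pos _) s.sum_exp_pos

theorem Exp4State.prob_mem {N : ℕ} [NeZero N] (s : Exp4State N) :
    s.prob ∈ stdSimplex ℝ (Fin N) := by
  refine ⟨fun i => (s.prob_pos i).le, ?_⟩
  simp only [Exp4State.prob, ← Finset.sum_div]
  exact div_self s.sum_exp_pos.ne'

theorem Exp4State.shannonEntropy_prob {N : ℕ} [NeZero N] (s : Exp4State N) :
    shannonEntropy s.prob = s.rate * ∑ i, s.prob i * s.cumLoss i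
      + Real.log (∑ j, Real.exp (-(s.rate * s.cumLoss j))) := by
  have : ∀ i, s.prob i * Real.log (1 / s.prob i) = s.rate * (s.prob i * s.cumLoss i)
      + s.prob i * Real.log (∑ j, Real.exp (-(s.rate * s.cumLoss j))) := by
    intro i
    have h : Real.log (1 / s.prob i)
        = s.rate * s.cumLoss i + Real.log (∑ j, Real.exp (-(s.rate * s.cumLoss j))) := by
      rw [Exp4State.prob, one_div, Real.log_inv,
        Real.log_div (Real.exp_pos _).ne' s.sum_exp_pos.ne', Real.log_exp]
      ring
    rw [h]; ring
  rw [shannonEntropy, Finset.sum_congr rfl fun i _ => this i, Finset.sum_add_distrib,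
    ← Finset.mul_sum, ← Finset.sum_mul, s.prob_mem.2, one_mul]

/-- The soft minimum `-b log ∑ exp (-L / b)`. -/
noncomputable def softMin {N : ℕ} (b : ℝ) (L : Fin N → ℝ) : ℝ :=
  -(b * Real.log (∑ i, Real.exp (-(1 / b * L i))))

theorem softMin_le {N : ℕ} [NeZero N] {b : ℝ} (hb : 0 < b) (L : Fin N → ℝ) {q : Fin N → ℝ}
    (hq : q ∈ stdSimplex ℝ (Fin N)) :
    softMin b L ≤ ∑ i, q i * L i - b * shannonEntropy q := by
  have h := mul_le_mul_of_nonneg_left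
    (shannonEntropy_le_add_log_sum_exp hq (fun i => 1 / b * L i)) hb.le
  have h2 : b * ∑ i, q i * (1 / b * L i) = ∑ i, q i * L i := by
    rw [Finset.mul_sum]
    refine Finset.sum_congr rfl fun i _ => ?_
    field_simp
  unfold softMin
  linarith [mul_add b (∑ i, q i * (1 / b * L i)) (Real.log (∑ i, Real.exp (-(1 / b * L i))))]

theorem softMin_le_apply {N : ℕ} {b : ℝ} (hb : 0 < b) (L : Fin N → ℝ) (j : Fin N) :
    softMin b L ≤ L j := by
  have h1 : Real.exp (-(1 / b * L j)) ≤ ∑ i, Real.exp (-(1 / b * L i)) :=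
    Finset.single_le_sum (f := fun i => Real.exp (-(1 / b * L i)))
      (fun i _ => (Real.exp_pos _).le) (Finset.mem_univ j)
  have h2 := mul_le_mul_of_nonneg_left (Real.log_le_log (Real.exp_pos _) h1) hb.le
  rw [Real.log_exp] at h2
  have h3 : b * -(1 / b * L j) = -L j := by field_simp
  unfold softMin
  linarith

/-- The exponential-weights distribution attains the minimum in `softMin_le`. -/
theorem Exp4State.softMin_eq {N : ℕ} [NeZero N] (s : Exp4State N) :
    softMin (max 1 s.β) s.cumLoss
      = ∑ i, s.prob i * s.cumLoss i - max 1 s.β * shannonEntropy s.prob := by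
  have hb : max 1 s.β ≠ 0 := (lt_of_lt_of_le one_pos (le_max_left _ _)).ne'
  rw [s.shannonEntropy_prob, softMin, Exp4State.rate]
  field_simp
  ring

/-- Changing the learning rate costs at most the entropy of the new distribution times the
change of the inverse learning rate. -/
theorem Exp4State.softMin_rate_change {N : ℕ} [NeZero N] {b : ℝ} (hb : 0 < b) (s : Exp4State N) :
    softMin b s.cumLoss
      ≤ softMin (max 1 s.β) s.cumLoss + (max 1 s.β - b) * shannonEntropy s.prob := by
  have := softMin_le hb s.cumLoss s.prob_mem
  rw [s.softMin_eq]
  linarith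

/-- The stability of exponential weights, for losses recentred by a constant `y`. -/
theorem Exp4State.le_softMin_add {N : ℕ} [NeZero N] (s : Exp4State N) (g : Fin N → ℝ) (y : ℝ)
    (hg : ∀ i, -1 ≤ g i - y) :
    softMin (max 1 s.β) s.cumLoss + ∑ i, s.prob i * g i
        - Real.exp 1 / 2 * s.rate * ∑ i, s.prob i * (g i - y) ^ 2
      ≤ softMin (max 1 s.β) (fun i => s.cumLoss i + g i) := by
  have hb1 : 1 ≤ max 1 s.β := le_max_left _ _
  have hb : 0 < max 1 s.β := lt_of_lt_of_le one_pos hb1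
  have hr : s.rate = 1 / max 1 s.β := rfl
  set b := max 1 s.β
  have hr0 : 0 < s.rate := by rw [hr]; positivity
  have hr1 : s.rate ≤ 1 := by rw [hr, div_le_one hb]; exact hb1
  have hbr : b * s.rate = 1 := by rw [hr]; field_simp
  set r := s.rate with hrdef
  set Z := ∑ j, Real.exp (-(r * s.cumLoss j)) with hZ
  have hZ0 : 0 < Z := s.sum_exp_pos
  -- The common shift `y` factors out of the partition function exactly, so recentring changes only
  -- the second-order term.
  have hsum : ∑ i, Real.exp (-(r * (s.cumLoss i + g i)))
      = Z * (Real.exp (-(r * y)) * ∑ i, s.prob i * Real.exp (-(r * (g i - y)))) := by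
    rw [Finset.mul_sum, Finset.mul_sum]
    refine Finset.sum_congr rfl fun i _ => ?_
    rw [Exp4State.prob, ← hrdef, ← hZ]
    have : Real.exp (-(r * (s.cumLoss i + g i))) = Real.exp (-(r * y))
        * (Real.exp (-(r * s.cumLoss i)) * Real.exp (-(r * (g i - y)))) := by
      rw [← Real.exp_add, ← Real.exp_add]; congr 1; ring
    rw [this]
    field_simp
  set W := ∑ i, s.prob i * Real.exp (-(r * (g i - y)))
  have hW0 : 0 < W :=
    Finset.sum_pos (fun i _ => mul_pos (s.prob_pos i) (Real.exp_pos _)) Finset.univ_nonempty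
  have hlog : Real.log (∑ i, Real.exp (-(r * (s.cumLoss i + g i))))
      = Real.log Z - r * y + Real.log W := by
    rw [hsum, Real.log_mul hZ0.ne' (by positivity), Real.log_mul (by positivity) hW0.ne',
      Real.log_exp]
    ring
  have hW : W ≤ 1 - r * (∑ i, s.prob i * g i - y)
      + Real.exp 1 / 2 * r ^ 2 * ∑ i, s.prob i * (g i - y) ^ 2 := by
    have h1 : ∀ i, s.prob i * Real.exp (-(r * (g i - y))) ≤
        s.prob i - r * (s.prob i * g i - s.prob i * y)
          + Real.exp 1 / 2 * r ^ 2 * (s.prob i * (g i - y) ^ 2) := by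
      intro i
      -- This is where the cap `r ≤ 1` on the learning rate is needed, with `g - y ≥ -1`.
      have h2 : -(r * (g i - y)) ≤ 1 := by nlinarith [hg i]
      have := mul_le_mul_of_nonneg_left (Real.exp_le_one_add_add_exp_one_half_mul_sq h2)
        (s.prob_pos i).le
      calc _ ≤ _ := this
        _ = _ := by ring
    refine (Finset.sum_le_sum fun i _ => h1 i).trans_eq ?_
    rw [Finset.sum_add_distrib, Finset.sum_sub_distrib, ← Finset.mul_sum, ← Finset.mul_sum,
      Finset.sum_sub_distrib, ← Finset.sum_mul, s.prob_mem.2, one_mul]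
  have hWlog := (Real.log_le_sub_one_of_pos hW0).trans (sub_le_sub_right hW 1)
  unfold softMin
  rw [← hr, ← hZ, hlog]
  have h3 := mul_le_mul_of_nonneg_left hWlog hb.le
  have h4 : b * (1 - r * (∑ i, s.prob i * g i - y)
      + Real.exp 1 / 2 * r ^ 2 * ∑ i, s.prob i * (g i - y) ^ 2 - 1)
      = -(∑ i, s.prob i * g i - y)
        + Real.exp 1 / 2 * r * ∑ i, s.prob i * (g i - y) ^ 2 := by
    have : ∀ u v : ℝ, b * (1 - r * u + Real.exp 1 / 2 * r ^ 2 * v - 1)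
        = b * r * (-u + Real.exp 1 / 2 * r * v) := by intros; ring
    rw [this, hbr, one_mul]
  rw [h4] at h3
  have h5 : b * (Real.log Z - r * y + Real.log W) = b * Real.log Z - y + b * Real.log W := by
    linear_combination (-y) * hbr
  rw [h5]
  linarith

/-! ### The trajectory of the algorithm -/

/-- The importance-weighted estimate of the loss of policy `i`. -/
noncomputable def lossEstimate {N K : ℕ} (θ : Fin N → Fin K → ℝ) (p : Fin N → ℝ) (x : Fin K)
    (y : ℝ) (i : Fin N) : ℝ :=
  θ i x / mixture θ p x * y

section Trajectory

variable {N K : ℕ} (θ : Fin N → Fin K → ℝ) (γ : ℝ) (obs : ℕ → Fin K × ℝ)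

theorem exp4State_succ_cumLoss (t : ℕ) :
    (exp4State θ γ obs (t + 1)).cumLoss = fun i => (exp4State θ γ obs t).cumLoss i
      + lossEstimate θ (exp4State θ γ obs t).prob (obs t).1 (obs t).2 i := rfl

theorem cumLoss_eq_sum (t : ℕ) (i : Fin N) :
    (exp4State θ γ obs t).cumLoss i = ∑ s ∈ Finset.range t,
      lossEstimate θ (exp4State θ γ obs s).prob (obs s).1 (obs s).2 i := by
  induction t with
  | zero => rfl
  | succ t ih => rw [Finset.sum_range_succ, ← ih]; rfl

theorem cumEntropy_eq_sum (t : ℕ) :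
    (exp4State θ γ obs t).cumEntropy = ∑ s ∈ Finset.range t,
      shannonEntropy (exp4State θ γ obs s).prob := by
  induction t with
  | zero => rfl
  | succ t ih => rw [Finset.sum_range_succ, ← ih]; rfl

theorem exp4State_succ_β (t : ℕ) : (exp4State θ γ obs (t + 1)).β = (exp4State θ γ obs t).β
      + γ / √(1 + 1 / Real.log N * (exp4State θ γ obs (t + 1)).cumEntropy) := rfl

theorem lossEstimate_nonneg (hθ : ∀ i, θ i ∈ stdSimplex ℝ (Fin K)) {p : Fin N → ℝ}
    (hp : p ∈ stdSimplex ℝ (Fin N)) (x : Fin K) {y : ℝ} (hy : 0 ≤ y) (i : Fin N) :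
    0 ≤ lossEstimate θ p x y i :=
  mul_nonneg (div_nonneg ((hθ i).1 x)
    (Finset.sum_nonneg fun j _ => mul_nonneg (hp.1 j) ((hθ j).1 x))) hy

theorem max_one_β_sub_le (hγ : 0 ≤ γ) (t : ℕ) :
    max 1 (exp4State θ γ obs (t + 1)).β - max 1 (exp4State θ γ obs t).β
      ≤ γ / √(1 + 1 / Real.log N * (exp4State θ γ obs (t + 1)).cumEntropy) := by
  have h := exp4State_succ_β θ γ obs t
  have h0 : 0 ≤ γ / √(1 + 1 / Real.log N * (exp4State θ γ obs (t + 1)).cumEntropy) := by positivity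
  rw [h, sub_le_iff_le_add]
  refine max_le ?_ ?_
  · linarith [le_max_left 1 (exp4State θ γ obs t).β]
  · linarith [le_max_right 1 (exp4State θ γ obs t).β]

variable [NeZero N]

theorem cumEntropy_nonneg (t : ℕ) : 0 ≤ (exp4State θ γ obs t).cumEntropy := by
  rw [cumEntropy_eq_sum]
  exact Finset.sum_nonneg fun s _ => shannonEntropy_nonneg (Exp4State.prob_mem _)

theorem cumEntropy_mono : Monotone fun t => (exp4State θ γ obs t).cumEntropy := by
  refine monotone_nat_of_le_succ fun t => ?_
  have := shannonEntropy_nonneg (exp4State θ γ obs t).prob_mem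
  change _ ≤ (exp4State θ γ obs t).cumEntropy + shannonEntropy (exp4State θ γ obs t).prob
  linarith

theorem shannonEntropy_prob_zero : shannonEntropy (exp4State θ γ obs 0).prob = Real.log N := by
  rw [Exp4State.shannonEntropy_prob]
  simp [exp4State, Exp4State.init]

/-- The regret bound for the estimated losses, along a fixed trajectory. -/
theorem sum_prob_mul_lossEstimate_le_softMin (hθ : ∀ i, θ i ∈ stdSimplex ℝ (Fin K)) (n : ℕ)
    (hobs : ∀ t ≤ n, (obs t).2 ∈ Set.Icc (0 : ℝ) 1) :
    ∑ t ∈ Finset.range (n + 1), (∑ i, (exp4State θ γ obs t).prob i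
          * lossEstimate θ (exp4State θ γ obs t).prob (obs t).1 (obs t).2 i
        - Real.exp 1 / 2 * (exp4State θ γ obs t).rate * ∑ i, (exp4State θ γ obs t).prob i
          * (lossEstimate θ (exp4State θ γ obs t).prob (obs t).1 (obs t).2 i - (obs t).2) ^ 2)
      ≤ softMin (max 1 (exp4State θ γ obs n).β) (exp4State θ γ obs (n + 1)).cumLoss
        + max 1 γ * Real.log N
        + ∑ t ∈ Finset.range n, (max 1 (exp4State θ γ obs (t + 1)).β
            - max 1 (exp4State θ γ obs t).β) * shannonEntropy (exp4State θ γ obs (t + 1)).prob := by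
  have step : ∀ t ≤ n, softMin (max 1 (exp4State θ γ obs t).β) (exp4State θ γ obs t).cumLoss
      + (∑ i, (exp4State θ γ obs t).prob i
          * lossEstimate θ (exp4State θ γ obs t).prob (obs t).1 (obs t).2 i
        - Real.exp 1 / 2 * (exp4State θ γ obs t).rate * ∑ i, (exp4State θ γ obs t).prob i
          * (lossEstimate θ (exp4State θ γ obs t).prob (obs t).1 (obs t).2 i - (obs t).2) ^ 2)
      ≤ softMin (max 1 (exp4State θ γ obs t).β) (exp4State θ γ obs (t + 1)).cumLoss := by
    intro t ht
    rw [exp4State_succ_cumLoss]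
    -- The centre is the observed loss: estimates are nonnegative and the loss is at most `1`, so
    -- the recentred estimates are at least `-1`.
    have := (exp4State θ γ obs t).le_softMin_add
      (lossEstimate θ (exp4State θ γ obs t).prob (obs t).1 (obs t).2) (obs t).2 (fun i => by
        have h1 := lossEstimate_nonneg θ hθ (exp4State θ γ obs t).prob_mem (obs t).1
          (hobs t ht).1 i
        linarith [(hobs t ht).2])
    linarith
  induction n with
  | zero =>
    have h := step 0 le_rfl
    -- The potential is not normalised by `N`, so it starts at `-b log N` rather than `0`.
    have h0 : softMin (max 1 (exp4State θ γ obs 0).β) (exp4State θ γ obs 0).cumLoss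
        = -(max 1 γ * Real.log N) := by
      simp [softMin, exp4State, Exp4State.init]
    rw [h0] at h
    simp only [zero_add, Finset.sum_range_one, Finset.sum_range_zero, add_zero] at h ⊢
    linarith
  | succ n ih =>
    have h1 := ih (fun t ht => hobs t (by omega)) (fun t ht => step t (by omega))
    have h2 := step (n + 1) le_rfl
    have h3 := (exp4State θ γ obs (n + 1)).softMin_rate_change
      (b := max 1 (exp4State θ γ obs n).β) (lt_of_lt_of_le one_pos (le_max_left _ _))
    have h4 := Finset.sum_range_succ (fun t => (max 1 (exp4State θ γ obs (t + 1)).β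
      - max 1 (exp4State θ γ obs t).β) * shannonEntropy (exp4State θ γ obs (t + 1)).prob) n
    rw [Finset.sum_range_succ, h4]
    linarith

/-- The total price of the changes of the learning rate. -/
theorem sum_rate_change_le (hN : 2 ≤ N) (hγ : 0 ≤ γ) (n : ℕ) :
    ∑ t ∈ Finset.range n, (max 1 (exp4State θ γ obs (t + 1)).β
        - max 1 (exp4State θ γ obs t).β) * shannonEntropy (exp4State θ γ obs (t + 1)).prob
      ≤ 2 * γ * Real.log N * (√(1 / Real.log N * (exp4State θ γ obs (n + 1)).cumEntropy) - 1) := by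
  have hlog : 0 < Real.log N := Real.log_pos (by exact_mod_cast hN)
  induction n with
  | zero =>
    -- Round `0` plays the uniform distribution, so the normalised entropy starts at exactly `1`;
    -- this produces the `- 1` in the bound.
    have : (exp4State θ γ obs (0 + 1)).cumEntropy = Real.log N := by
      rw [cumEntropy_eq_sum]; simp [shannonEntropy_prob_zero]
    rw [this, one_div, inv_mul_cancel₀ hlog.ne']
    simp
  | succ n ih =>
    rw [Finset.sum_range_succ]
    set c := (exp4State θ γ obs (n + 1)).cumEntropy with hc
    have hc0 : 0 ≤ c := cumEntropy_nonneg θ γ obs _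
    set H := shannonEntropy (exp4State θ γ obs (n + 1)).prob with hH
    have hH0 : 0 ≤ H := shannonEntropy_nonneg (Exp4State.prob_mem _)
    have hH1 : H ≤ Real.log N := shannonEntropy_le_log (Exp4State.prob_mem _)
    have hs : (exp4State θ γ obs (n + 1 + 1)).cumEntropy = c + H := rfl
    have h1 := mul_le_mul_of_nonneg_right (max_one_β_sub_le θ γ obs hγ n) hH0
    have h2 := div_sqrt_one_add_le (S := 1 / Real.log N * c) (h := 1 / Real.log N * H)
      (by positivity) (by positivity) (by rw [one_div, inv_mul_le_one₀ hlog]; exact hH1)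
    rw [hs, mul_add]
    have h3 := mul_le_mul_of_nonneg_left h2 (mul_nonneg hγ hlog.le)
    have h4 : γ * Real.log N * (1 / Real.log N * H / √(1 + 1 / Real.log N * c))
        = γ / √(1 + 1 / Real.log N * c) * H := by field_simp
    rw [h4] at h3
    linarith

/-- The cumulative entropy is nondecreasing, so the initial value `γ` and each of the `t` increments
are at least `γ` over the final square root. -/
theorem mul_div_sqrt_le_β (hN : 2 ≤ N) (hγ : 0 ≤ γ) (n t : ℕ) (ht : t ≤ n) :
    γ * (t + 1) / √(1 + 1 / Real.log N * (exp4State θ γ obs n).cumEntropy)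
      ≤ (exp4State θ γ obs t).β := by
  have hlog : 0 < Real.log N := Real.log_pos (by exact_mod_cast hN)
  set S := √(1 + 1 / Real.log N * (exp4State θ γ obs n).cumEntropy)
  have hS1 : 1 ≤ S := by
    rw [Real.one_le_sqrt]
    have := cumEntropy_nonneg θ γ obs n
    have : 0 ≤ 1 / Real.log N * (exp4State θ γ obs n).cumEntropy := by positivity
    linarith
  induction t with
  | zero =>
    have : (exp4State θ γ obs 0).β = γ := rfl
    rw [this, Nat.cast_zero, zero_add, mul_one]
    exact div_le_self hγ hS1
  | succ t ih =>
    have h1 := ih (by omega)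
    rw [exp4State_succ_β]
    have h2 : γ / S ≤ γ / √(1 + 1 / Real.log N * (exp4State θ γ obs (t + 1)).cumEntropy) := by
      refine div_le_div_of_nonneg_left hγ ?_ ?_
      · have := cumEntropy_nonneg θ γ obs (t + 1)
        positivity
      · refine Real.sqrt_le_sqrt ?_
        have := mul_le_mul_of_nonneg_left (cumEntropy_mono θ γ obs ht)
          (one_div_pos.2 hlog).le
        simpa using this
    have h3 : γ * ((t + 1 : ℕ) + 1) / S = γ * (t + 1) / S + γ / S := by push_cast; ring
    rw [h3]
    linarith

/-- Linear growth of `β` bounds the rates by a multiple of the harmonic series. The factor `γ ^ 2`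
avoids a division, so that `γ = 0`, which occurs for zero capacity, is included. -/
theorem sq_mul_sum_rate_le (hN : 2 ≤ N) (hγ : 0 ≤ γ) (n : ℕ) :
    γ ^ 2 * ∑ t ∈ Finset.range (n + 1), (exp4State θ γ obs t).rate
      ≤ γ * √(1 + 1 / Real.log N * (exp4State θ γ obs (n + 1)).cumEntropy)
        * Real.log (Real.exp 1 * (n + 1 : ℕ)) := by
  have hlog : 0 < Real.log N := Real.log_pos (by exact_mod_cast hN)
  set S := √(1 + 1 / Real.log N * (exp4State θ γ obs (n + 1)).cumEntropy) with hSdef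
  have hS : 0 < S := by
    have := cumEntropy_nonneg θ γ obs (n + 1)
    positivity
  rcases hγ.eq_or_lt with h | h
  · simp [← h]
  have h1 : ∀ t ∈ Finset.range (n + 1), γ ^ 2 * (exp4State θ γ obs t).rate
      ≤ γ * S * ((t + 1 : ℕ) : ℝ)⁻¹ := by
    intro t ht
    have hb := mul_div_sqrt_le_β θ γ obs hN hγ (n + 1) t (Finset.mem_range.1 ht).le
    rw [← hSdef] at hb
    have hpos : 0 < γ * (t + 1) / S := by positivity
    have h2 : (exp4State θ γ obs t).rate ≤ 1 / (γ * (t + 1) / S) :=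
      one_div_le_one_div_of_le hpos (hb.trans (le_max_right _ _))
    calc _ ≤ γ ^ 2 * (1 / (γ * (t + 1) / S)) := by gcongr
      _ = _ := by push_cast; field_simp
  rw [Finset.mul_sum]
  refine (Finset.sum_le_sum h1).trans ?_
  rw [← Finset.mul_sum]
  refine mul_le_mul_of_nonneg_left ?_ (by positivity)
  have h3 := harmonic_le_one_add_log (n + 1)
  rw [Real.log_mul (Real.exp_pos 1).ne' (by positivity), Real.log_exp]
  simpa [harmonic] using h3

/-- Penalty and stability together, along a trajectory. -/
theorem penalty_add_stability_le (hN : 2 ≤ N) (hγ : 0 ≤ γ) {n : ℕ} {C : ℝ}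
    (hC : γ ^ 2 * Real.log N
      = Real.exp 1 / 2 * C * Real.log (Real.exp 1 * (n + 1 : ℕ))) :
    max 1 γ * Real.log N
        + ∑ t ∈ Finset.range n, (max 1 (exp4State θ γ obs (t + 1)).β
          - max 1 (exp4State θ γ obs t).β) * shannonEntropy (exp4State θ γ obs (t + 1)).prob
        + Real.exp 1 / 2 * C * ∑ t ∈ Finset.range (n + 1), (exp4State θ γ obs t).rate
      ≤ Real.log N
        + 3 * γ * Real.log N * √(1 / Real.log N * (exp4State θ γ obs (n + 1)).cumEntropy) := by
  have hlog : 0 < Real.log N := Real.log_pos (by exact_mod_cast hN)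
  have hlogT : 0 < Real.log (Real.exp 1 * (n + 1 : ℕ)) := by
    rw [Real.log_mul (Real.exp_pos 1).ne' (by positivity), Real.log_exp]
    have := Real.log_nonneg (show (1 : ℝ) ≤ (n + 1 : ℕ) by exact_mod_cast Nat.succ_pos n)
    linarith
  have h1 := sum_rate_change_le θ γ obs hN hγ n
  have h2 := sq_mul_sum_rate_le θ γ obs hN hγ n
  set R := ∑ t ∈ Finset.range (n + 1), (exp4State θ γ obs t).rate
  set A := 1 / Real.log N * (exp4State θ γ obs (n + 1)).cumEntropy with hA
  have hA0 : 0 ≤ A := mul_nonneg (by positivity) (cumEntropy_nonneg θ γ obs _)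
  have h3 : √(1 + A) ≤ 1 + √A := by
    rw [Real.sqrt_le_left (by positivity)]
    nlinarith [Real.sq_sqrt hA0, Real.sqrt_nonneg A]
  have h4 : Real.exp 1 / 2 * C * R ≤ γ * √(1 + A) * Real.log N := by
    refine le_of_mul_le_mul_right ?_ hlogT
    calc Real.exp 1 / 2 * C * R * Real.log (Real.exp 1 * (n + 1 : ℕ))
        = γ ^ 2 * R * Real.log N := by linear_combination (-R) * hC
      _ ≤ γ * √(1 + A) * Real.log (Real.exp 1 * (n + 1 : ℕ)) * Real.log N := by gcongr
      _ = _ := by ring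
  have h5 : γ * √(1 + A) * Real.log N ≤ γ * (1 + √A) * Real.log N := by gcongr
  -- The terms in `γ log N` free of `√A` cancel: `+1` here, `+1` from `h5`, and `-2` from the rate
  -- changes.
  have h6 : max 1 γ * Real.log N ≤ (1 + γ) * Real.log N := by
    gcongr; exact max_le (by linarith) (by linarith)
  linarith

end Trajectory

/-! ### Moments of the loss estimates and a priori bounds -/

section Trajectory

variable {N K : ℕ} {θ : Fin N → Fin K → ℝ} {p : Fin N → ℝ}

theorem sum_sum_mul_eq_mixture (θ : Fin N → Fin K → ℝ) (p : Fin N → ℝ) (F : Fin K → ℝ) :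
    ∑ i, ∑ x, p i * θ i x * F x = ∑ x, mixture θ p x * F x := by
  rw [Finset.sum_comm]
  simp only [mixture, Finset.sum_mul]

/-- The loss estimate is unbiased. -/
theorem sum_mixture_mul_lossEstimate (hθ : ∀ i, θ i ∈ stdSimplex ℝ (Fin K))
    (hp : p ∈ stdSimplex ℝ (Fin N)) (l : Fin K → ℝ) {i : Fin N} (hi : p i ≠ 0) :
    ∑ x, mixture θ p x * lossEstimate θ p x (l x) i = policyLoss θ l i := by
  refine Finset.sum_congr rfl fun x _ => ?_
  rw [lossEstimate]
  -- Outcomes outside the support of policy `i` contribute zero even where the mixture vanishes; on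
  -- the support, `p i ≠ 0` makes the mixture nonzero.
  by_cases hx : θ i x = 0
  · simp [hx]
  · have := mixture_ne_zero hθ hp hi hx
    field_simp

/-- The recentred estimate is `l x * (θ i x / mixture θ p x - 1)`; since `l x ^ 2 ≤ 1`, its second
moment is at most the chi-squared information of `p`. -/
theorem sum_mixture_mul_sq_le_capacity (hθ : ∀ i, θ i ∈ stdSimplex ℝ (Fin K))
    (hp : p ∈ stdSimplex ℝ (Fin N)) {l : Fin K → ℝ} (hl : ∀ x, l x ∈ Set.Icc (0 : ℝ) 1) :
    ∑ x, mixture θ p x * ∑ i, p i * (lossEstimate θ p x (l x) i - l x) ^ 2 ≤ capacity θ := by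
  refine le_trans ?_ (le_csSup (bddAbove_chiSqInfo hθ) ⟨p, hp, rfl⟩)
  simp only [chiSqInfo, chiSqDiv, Finset.mul_sum]
  rw [Finset.sum_comm]
  refine Finset.sum_le_sum fun i _ => Finset.sum_le_sum fun x _ => ?_
  have hm : 0 ≤ mixture θ p x := Finset.sum_nonneg fun j _ => mul_nonneg (hp.1 j) ((hθ j).1 x)
  have h1 : (lossEstimate θ p x (l x) i - l x) ^ 2
      = (θ i x / mixture θ p x - 1) ^ 2 * l x ^ 2 := by rw [lossEstimate]; ring
  have h2 : l x ^ 2 ≤ 1 := pow_le_one₀ (hl x).1 (hl x).2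
  have h3 := mul_le_of_le_one_right
    (mul_nonneg (mul_nonneg (hp.1 i) hm) (sq_nonneg (θ i x / mixture θ p x - 1))) h2
  rw [h1]
  linarith

theorem lossEstimate_le_one_div (hθ : ∀ i, θ i ∈ stdSimplex ℝ (Fin K))
    (hp : p ∈ stdSimplex ℝ (Fin N)) (x : Fin K) {y : ℝ} (hy : y ∈ Set.Icc (0 : ℝ) 1)
    {i : Fin N} (hi : 0 < p i) : lossEstimate θ p x y i ≤ 1 / p i := by
  rw [lossEstimate]
  by_cases hx : θ i x = 0
  · simp [hx, hi.le]
  · have hx0 : 0 < θ i x := lt_of_le_of_ne ((hθ i).1 x) (Ne.symm hx)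
    have hle := le_mixture hθ hp i x
    have hm : 0 < mixture θ p x := (mul_pos hi hx0).trans_le hle
    have h1 : θ i x / mixture θ p x ≤ 1 / p i := by
      rw [div_le_div_iff₀ hm hi]
      linarith
    exact (mul_le_of_le_one_right (div_nonneg hx0.le hm.le) hy.2).trans h1

theorem Exp4State.rate_nonneg (s : Exp4State N) : 0 ≤ s.rate :=
  one_div_nonneg.2 (zero_le_one.trans (le_max_left _ _))

theorem Exp4State.rate_le_one (s : Exp4State N) : s.rate ≤ 1 :=
  div_le_one_of_le₀ (le_max_left _ _) (zero_le_one.trans (le_max_left _ _))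

theorem Exp4State.le_prob (s : Exp4State N) (h0 : ∀ i, 0 ≤ s.cumLoss i) {M : ℝ}
    (hM : ∀ i, s.cumLoss i ≤ M) (i : Fin N) : Real.exp (-M) / N ≤ s.prob i := by
  have : NeZero N := ⟨by rintro rfl; exact i.elim0⟩
  have h1 : s.rate * s.cumLoss i ≤ M :=
    (mul_le_of_le_one_left (h0 i) s.rate_le_one).trans (hM i)
  have h2 : ∑ j, Real.exp (-(s.rate * s.cumLoss j)) ≤ N := by
    have : ∀ j ∈ Finset.univ, Real.exp (-(s.rate * s.cumLoss j)) ≤ 1 := fun j _ =>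
      Real.exp_le_one_iff.2 (neg_nonpos.2 (mul_nonneg s.rate_nonneg (h0 j)))
    simpa using Finset.sum_le_sum this
  exact div_le_div₀ (Real.exp_pos _).le (Real.exp_le_exp.2 (neg_le_neg h1)) s.sum_exp_pos h2

variable [NeZero N]

theorem cumLoss_nonneg (hθ : ∀ i, θ i ∈ stdSimplex ℝ (Fin K)) (γ : ℝ) {obs : ℕ → Fin K × ℝ}
    {t : ℕ} (hobs : ∀ s < t, (obs s).2 ∈ Set.Icc (0 : ℝ) 1) (i : Fin N) :
    0 ≤ (exp4State θ γ obs t).cumLoss i := by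
  rw [cumLoss_eq_sum]
  exact Finset.sum_nonneg fun s hs => lossEstimate_nonneg θ hθ (Exp4State.prob_mem _) _
    (hobs s (Finset.mem_range.1 hs)).1 i

/-- The cumulative estimated losses are bounded uniformly over all trajectories. -/
theorem exists_cumLoss_le (hθ : ∀ i, θ i ∈ stdSimplex ℝ (Fin K)) (γ : ℝ) (t : ℕ) :
    ∃ M : ℝ, ∀ obs : ℕ → Fin K × ℝ, (∀ s < t, (obs s).2 ∈ Set.Icc (0 : ℝ) 1) →
      ∀ i, (exp4State θ γ obs t).cumLoss i ≤ M := by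
  induction t with
  | zero => exact ⟨0, fun obs _ i => le_rfl⟩
  | succ t ih =>
    obtain ⟨M, hM⟩ := ih
    -- A bound `M` on the cumulative losses keeps every probability above `exp (-M) / N`, hence the
    -- next estimate below its inverse. The bound is crude and serves only integrability.
    refine ⟨M + 1 / (Real.exp (-M) / N), fun obs hobs i => ?_⟩
    have hobs' : ∀ s < t, (obs s).2 ∈ Set.Icc (0 : ℝ) 1 := fun s hs => hobs s (by omega)
    have hN : (0 : ℝ) < N := by exact_mod_cast Nat.pos_of_ne_zero (NeZero.ne N)
    have h1 := (exp4State θ γ obs t).le_prob (cumLoss_nonneg hθ γ hobs') (hM obs hobs') i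
    rw [exp4State_succ_cumLoss]
    refine add_le_add (hM obs hobs' i) ((lossEstimate_le_one_div hθ (Exp4State.prob_mem _) _
      (hobs t (by omega)) (Exp4State.prob_pos _ _)).trans ?_)
    exact one_div_le_one_div_of_le (by positivity) h1

theorem exists_le_prob (hθ : ∀ i, θ i ∈ stdSimplex ℝ (Fin K)) (γ : ℝ) (t : ℕ) :
    ∃ δ : ℝ, 0 < δ ∧ ∀ obs : ℕ → Fin K × ℝ, (∀ s < t, (obs s).2 ∈ Set.Icc (0 : ℝ) 1) →
      ∀ i, δ ≤ (exp4State θ γ obs t).prob i := by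
  obtain ⟨M, hM⟩ := exists_cumLoss_le hθ γ t
  have hN : (0 : ℝ) < N := by exact_mod_cast Nat.pos_of_ne_zero (NeZero.ne N)
  exact ⟨Real.exp (-M) / N, by positivity, fun obs hobs i =>
    (exp4State θ γ obs t).le_prob (cumLoss_nonneg hθ γ hobs) (hM obs hobs) i⟩

end Trajectory

/-! ### Measurability -/

section Measurability

variable {N K : ℕ} {Ω : Type*} [MeasurableSpace Ω]

theorem Exp4State.measurable_rate {s : Ω → Exp4State N} (hβ : Measurable fun ω => (s ω).β) :
    Measurable fun ω => (s ω).rate := by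
  unfold Exp4State.rate
  fun_prop

theorem Exp4State.measurable_prob {s : Ω → Exp4State N} (hβ : Measurable fun ω => (s ω).β)
    (hL : ∀ i, Measurable fun ω => (s ω).cumLoss i) (i : Fin N) :
    Measurable fun ω => (s ω).prob i := by
  have := Exp4State.measurable_rate hβ
  unfold Exp4State.prob
  fun_prop

theorem measurable_shannonEntropy {p : Ω → Fin N → ℝ} (hp : ∀ i, Measurable fun ω => p ω i) :
    Measurable fun ω => shannonEntropy (p ω) := by
  unfold shannonEntropy
  fun_prop

theorem measurable_lossEstimate (θ : Fin N → Fin K → ℝ) {p : Ω → Fin N → ℝ}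
    (hp : ∀ i, Measurable fun ω => p ω i) {x : Ω → Fin K} (hx : Measurable x) {y : Ω → ℝ}
    (hy : Measurable y) (i : Fin N) :
    Measurable fun ω => lossEstimate θ (p ω) (x ω) (y ω) i := by
  have h : ∀ j, Measurable fun ω => θ j (x ω) := fun j => (measurable_of_finite (θ j)).comp hx
  unfold lossEstimate mixture
  fun_prop

/-- The sigma-algebra on `Ω` is arbitrary: taken to be the history, it makes the distribution and
rate of round `t` predictable. -/
theorem measurable_exp4State (θ : Fin N → Fin K → ℝ) (γ : ℝ) {obs : Ω → ℕ → Fin K × ℝ} {t : ℕ}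
    (hobs : ∀ s < t, Measurable fun ω => obs ω s) :
    (∀ i, Measurable fun ω => (exp4State θ γ (obs ω) t).cumLoss i) ∧
      (Measurable fun ω => (exp4State θ γ (obs ω) t).β) ∧
      Measurable fun ω => (exp4State θ γ (obs ω) t).cumEntropy := by
  induction t with
  | zero => exact ⟨fun i => measurable_const, measurable_const, measurable_const⟩
  | succ t ih =>
    obtain ⟨h1, h2, h3⟩ := ih fun s hs => hobs s (by omega)
    have hp := Exp4State.measurable_prob h2 h1
    have hH := measurable_shannonEntropy hp
    have ho := hobs t (by omega)
    refine ⟨fun i => (h1 i).add (measurable_lossEstimate θ hp ho.fst ho.snd i), ?_, h3.add hH⟩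
    simp only [exp4State, Exp4State.update]
    fun_prop

end Measurability

/-! ### Expectations -/

section Run

variable {Ω : Type*} {N K T : ℕ}
  {θ : Fin N → Fin K → ℝ} {γ : ℝ} {ℓ : ℕ → Ω → Fin K → ℝ} {ϑ : ℕ → Ω → Fin N} {O : ℕ → Ω → Fin K}

/-- The state of the algorithm at round `t` of a run. -/
noncomputable abbrev runState (θ : Fin N → Fin K → ℝ) (γ : ℝ) (ℓ : ℕ → Ω → Fin K → ℝ)
    (O : ℕ → Ω → Fin K) (t : ℕ) (ω : Ω) : Exp4State N :=
  exp4State θ γ (fun s => (O s ω, ℓ s ω (O s ω))) t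

/-- The loss estimates at round `t` of a run. -/
noncomputable abbrev runEstimate (θ : Fin N → Fin K → ℝ) (γ : ℝ) (ℓ : ℕ → Ω → Fin K → ℝ)
    (O : ℕ → Ω → Fin K) (t : ℕ) (ω : Ω) : Fin N → ℝ :=
  lossEstimate θ (runState θ γ ℓ O t ω).prob (O t ω) (ℓ t ω (O t ω))

theorem measurable_history {s t : ℕ} (hst : s < t) :
    Measurable[historySigma ℓ ϑ O t] fun ω => (ϑ s ω, O s ω, ℓ s ω (O s ω)) := by
  refine Measurable.mono (comap_measurable _) ?_ le_rfl
  exact le_iSup₂_of_le (f := fun s (_ : s < t) =>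
    MeasurableSpace.comap (fun ω => (ϑ s ω, O s ω, ℓ s ω (O s ω))) inferInstance) s hst le_rfl

theorem measurable_runState_history (θ : Fin N → Fin K → ℝ) (γ : ℝ) (t : ℕ) :
    (∀ i, Measurable[historySigma ℓ ϑ O t] fun ω => (runState θ γ ℓ O t ω).prob i) ∧
      Measurable[historySigma ℓ ϑ O t] fun ω => (runState θ γ ℓ O t ω).rate := by
  have h := @measurable_exp4State N K Ω (historySigma ℓ ϑ O t) θ γ
    (fun ω s => (O s ω, ℓ s ω (O s ω))) t
    (fun s hs => (@measurable_snd _ _ _ _).comp (measurable_history hs))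
  exact ⟨@Exp4State.measurable_prob N Ω (historySigma ℓ ϑ O t) _ h.2.1 h.1,
    @Exp4State.measurable_rate N Ω (historySigma ℓ ϑ O t) _ h.2.1⟩

theorem measurable_eval_apply {mΩ : MeasurableSpace Ω} {l : Ω → Fin K → ℝ} (hl : Measurable l)
    {x : Ω → Fin K} (hx : Measurable x) : Measurable fun ω => l ω (x ω) := by
  have : (fun ω => l ω (x ω)) = fun ω => ∑ k, if x ω = k then l ω k else 0 := by
    funext ω; simp
  rw [this]
  refine Finset.measurable_sum _ fun k _ => Measurable.ite (hx (measurableSet_singleton k))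
    ((measurable_pi_apply k).comp hl) measurable_const

theorem policyLoss_mem (hθ : ∀ i, θ i ∈ stdSimplex ℝ (Fin K)) {l : Fin K → ℝ}
    (hl : ∀ x, l x ∈ Set.Icc (0 : ℝ) 1) (i : Fin N) : policyLoss θ l i ∈ Set.Icc (0 : ℝ) 1 := by
  refine ⟨Finset.sum_nonneg fun x _ => mul_nonneg ((hθ i).1 x) (hl x).1, ?_⟩
  rw [← (hθ i).2]
  exact Finset.sum_le_sum fun x _ => mul_le_of_le_one_right ((hθ i).1 x) (hl x).2

theorem measurable_policyLoss {mΩ : MeasurableSpace Ω} {l : Ω → Fin K → ℝ} (hl : Measurable l)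
    (i : Fin N) : Measurable fun ω => policyLoss θ (l ω) i := by
  unfold policyLoss
  fun_prop

theorem measurable_loss_lossSigma {t : ℕ} (ht : t < T) : Measurable[lossSigma ℓ T] (ℓ t) := by
  refine Measurable.mono (comap_measurable _) ?_ le_rfl
  exact le_iSup₂_of_le (f := fun s (_ : s < T) => MeasurableSpace.comap (ℓ s) inferInstance)
    t ht le_rfl

theorem measurable_estimate_sigma {t : ℕ} (ht : t < T) (x : Fin K) (i : Fin N) :
    Measurable[lossSigma ℓ T ⊔ historySigma ℓ ϑ O t] fun ω =>
      lossEstimate θ (runState θ γ ℓ O t ω).prob x (ℓ t ω x) i :=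
  @measurable_lossEstimate N K Ω (lossSigma ℓ T ⊔ historySigma ℓ ϑ O t) θ _
    (fun j => ((measurable_runState_history (ϑ := ϑ) θ γ t).1 j).mono le_sup_right le_rfl)
    _ measurable_const _
    ((measurable_pi_apply x).comp ((measurable_loss_lossSigma ht).mono le_sup_left le_rfl)) i

variable [MeasurableSpace Ω] {μ : Measure Ω}

namespace IsExp4Run

variable (hrun : IsExp4Run μ θ γ T ℓ ϑ O)
include hrun

theorem measurable_observed {t : ℕ} (ht : t < T) : Measurable fun ω => ℓ t ω (O t ω) :=
  measurable_eval_apply (hrun.measurable_loss t ht) (hrun.measurable_outcome t ht)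

theorem historySigma_le {t : ℕ} (ht : t ≤ T) : historySigma ℓ ϑ O t ≤ ‹MeasurableSpace Ω› := by
  refine iSup₂_le fun s hs => Measurable.comap_le ?_
  have hs' : s < T := hs.trans_le ht
  exact (hrun.measurable_policy s hs').prodMk
    ((hrun.measurable_outcome s hs').prodMk (hrun.measurable_observed hs'))

theorem sigma_le {t : ℕ} (ht : t ≤ T) :
    lossSigma ℓ T ⊔ historySigma ℓ ϑ O t ≤ ‹MeasurableSpace Ω› :=
  sup_le (iSup₂_le fun s hs => (hrun.measurable_loss s hs).comap_le) (hrun.historySigma_le ht)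

theorem obs_mem {t : ℕ} (ht : t ≤ T) (ω : Ω) (s : ℕ) (hs : s < t) :
    ((fun s => (O s ω, ℓ s ω (O s ω))) s).2 ∈ Set.Icc (0 : ℝ) 1 :=
  hrun.loss_mem s (hs.trans_le ht) ω _

theorem measurable_apply_policy_outcome {t : ℕ} (ht : t < T) {f : Fin N → Fin K → Ω → ℝ}
    (hf : ∀ i x, Measurable (f i x)) : Measurable fun ω => f (ϑ t ω) (O t ω) ω := by
  have : (fun ω => f (ϑ t ω) (O t ω) ω)
      = fun ω => ∑ i, ∑ x, if ϑ t ω = i ∧ O t ω = x then f i x ω else 0 := by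
    funext ω
    rw [Finset.sum_eq_single (ϑ t ω) (fun i _ hi => by simp [hi.symm]) (by simp)]
    simp
  rw [this]
  refine Finset.measurable_sum _ fun i _ => Finset.measurable_sum _ fun x _ =>
    Measurable.ite ?_ (hf i x) measurable_const
  exact (hrun.measurable_policy t ht (measurableSet_singleton i)).inter
    (hrun.measurable_outcome t ht (measurableSet_singleton x))

/-- The policy and the outcome are integrated out given the losses and the history. -/
theorem integral_apply_policy_outcome [IsProbabilityMeasure μ] {t : ℕ} (ht : t < T)
    {f : Fin N → Fin K → Ω → ℝ}
    (hf : ∀ i x, Measurable[lossSigma ℓ T ⊔ historySigma ℓ ϑ O t] (f i x)) {B : ℝ}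
    (hB : ∀ i x ω, |f i x ω| ≤ B) :
    ∫ ω, f (ϑ t ω) (O t ω) ω ∂μ
      = ∫ ω, ∑ i, ∑ x, (runState θ γ ℓ O t ω).prob i * θ i x * f i x ω ∂μ := by
  have hm := hrun.sigma_le ht.le
  have hA : ∀ i x, MeasurableSet {ω | ϑ t ω = i ∧ O t ω = x} := fun i x =>
    (hrun.measurable_policy t ht (measurableSet_singleton i)).inter
      (hrun.measurable_outcome t ht (measurableSet_singleton x))
  have hfint : ∀ i x, Integrable (f i x) μ := fun i x =>
    Integrable.of_bound ((hf i x).mono hm le_rfl).aestronglyMeasurable B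
      (Filter.Eventually.of_forall fun ω => hB i x ω)
  have hind : ∀ i x, Integrable
      (Set.indicator {ω | ϑ t ω = i ∧ O t ω = x} (fun _ => (1 : ℝ))) μ := fun i x =>
    (integrable_const 1).indicator (hA i x)
  have hmul : ∀ i x, Integrable
      (Set.indicator {ω | ϑ t ω = i ∧ O t ω = x} (fun _ => (1 : ℝ)) * f i x) μ := by
    intro i x
    have : Set.indicator {ω | ϑ t ω = i ∧ O t ω = x} (fun _ => (1 : ℝ)) * f i x
        = Set.indicator {ω | ϑ t ω = i ∧ O t ω = x} (f i x) := by
      funext ω; simp [Set.indicator_apply]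
    rw [this]
    exact (hfint i x).indicator (hA i x)
  -- The factor `f i x` is known given losses and history, so it leaves the conditional expectation
  -- and `cond_law` evaluates the rest.
  have hcond : ∀ i x, μ[Set.indicator {ω | ϑ t ω = i ∧ O t ω = x} (fun _ => (1 : ℝ)) * f i x |
      lossSigma ℓ T ⊔ historySigma ℓ ϑ O t]
      =ᵐ[μ] fun ω => (runState θ γ ℓ O t ω).prob i * θ i x * f i x ω := by
    intro i x
    filter_upwards [condExp_mul_of_stronglyMeasurable_right (hf i x).stronglyMeasurable
      (hmul i x) (hind i x), hrun.cond_law t ht i x] with ω h1 h2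
    rw [h1, Pi.mul_apply, h2]
    rfl
  have hsum : ∀ ω, f (ϑ t ω) (O t ω) ω = ∑ i, ∑ x,
      (Set.indicator {ω | ϑ t ω = i ∧ O t ω = x} (fun _ => (1 : ℝ)) * f i x) ω := by
    intro ω
    rw [Finset.sum_eq_single (ϑ t ω)
      (fun i _ hi => by simp [hi.symm]) (by simp)]
    simp [Set.indicator_apply]
  have hint : ∀ i x, Integrable
      (fun ω => (runState θ γ ℓ O t ω).prob i * θ i x * f i x ω) μ := fun i x =>
    integrable_condExp.congr (hcond i x)
  simp only [hsum]
  rw [integral_finsetSum _ fun i _ => integrable_finsetSum _ fun x _ => hmul i x,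
    integral_finsetSum _ fun i _ => integrable_finsetSum _ fun x _ => hint i x]
  refine Finset.sum_congr rfl fun i _ => ?_
  rw [integral_finsetSum _ fun x _ => hmul i x, integral_finsetSum _ fun x _ => hint i x]
  refine Finset.sum_congr rfl fun x _ => ?_
  rw [← integral_condExp hm, integral_congr_ae (hcond i x)]

theorem measurable_prob {t : ℕ} (ht : t ≤ T) (i : Fin N) :
    Measurable fun ω => (runState θ γ ℓ O t ω).prob i :=
  ((measurable_runState_history (ϑ := ϑ) θ γ t).1 i).mono (hrun.historySigma_le ht) le_rfl

theorem measurable_rate {t : ℕ} (ht : t ≤ T) :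
    Measurable fun ω => (runState θ γ ℓ O t ω).rate :=
  (measurable_runState_history (ϑ := ϑ) θ γ t).2.mono (hrun.historySigma_le ht) le_rfl

theorem measurable_runEstimate {t : ℕ} (ht : t < T) (i : Fin N) :
    Measurable fun ω => runEstimate θ γ ℓ O t ω i :=
  measurable_lossEstimate θ (hrun.measurable_prob ht.le) (hrun.measurable_outcome t ht)
    (hrun.measurable_observed ht) i

variable (hθ : ∀ i, θ i ∈ stdSimplex ℝ (Fin K))
include hθ

theorem integral_policyLoss_policy [IsProbabilityMeasure μ] {t : ℕ} (ht : t < T) :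
    ∫ ω, policyLoss θ (ℓ t ω) (ϑ t ω) ∂μ
      = ∫ ω, ∑ i, (runState θ γ ℓ O t ω).prob i * policyLoss θ (ℓ t ω) i ∂μ := by
  rw [hrun.integral_apply_policy_outcome ht (f := fun i _ ω => policyLoss θ (ℓ t ω) i) (B := 1)]
  · congr 1
    funext ω
    refine Finset.sum_congr rfl fun i _ => ?_
    rw [← Finset.sum_mul, ← Finset.mul_sum, (hθ i).2, mul_one]
  · exact fun i x => measurable_policyLoss (mΩ := lossSigma ℓ T ⊔ historySigma ℓ ϑ O t)
      ((measurable_loss_lossSigma ht).mono le_sup_left le_rfl) i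
  · intro i x ω
    have := policyLoss_mem hθ (hrun.loss_mem t ht ω) i
    exact abs_le.2 ⟨by linarith [this.1], this.2⟩

variable [NeZero N]

theorem exists_estimate_mem {t : ℕ} (ht : t < T) : ∃ B : ℝ, 0 ≤ B ∧ ∀ ω x i,
    lossEstimate θ (runState θ γ ℓ O t ω).prob x (ℓ t ω x) i ∈ Set.Icc 0 B := by
  obtain ⟨δ, hδ, h⟩ := exists_le_prob hθ γ t
  refine ⟨1 / δ, by positivity, fun ω x i => ⟨lossEstimate_nonneg θ hθ (Exp4State.prob_mem _) x
    (hrun.loss_mem t ht ω x).1 i, ?_⟩⟩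
  exact (lossEstimate_le_one_div hθ (Exp4State.prob_mem _) x (hrun.loss_mem t ht ω x)
    (Exp4State.prob_pos _ i)).trans
      (one_div_le_one_div_of_le hδ (h _ (hrun.obs_mem ht.le ω) i))

theorem integral_runEstimate [IsProbabilityMeasure μ] {t : ℕ} (ht : t < T) (j : Fin N) :
    ∫ ω, runEstimate θ γ ℓ O t ω j ∂μ = ∫ ω, policyLoss θ (ℓ t ω) j ∂μ := by
  obtain ⟨B, hB0, hB⟩ := hrun.exists_estimate_mem hθ ht
  rw [hrun.integral_apply_policy_outcome ht (f := fun _ x ω =>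
    lossEstimate θ (runState θ γ ℓ O t ω).prob x (ℓ t ω x) j) (B := B)
    (fun _ x => measurable_estimate_sigma ht x j)
    (fun _ x ω => abs_le.2 ⟨by linarith [(hB ω x j).1], (hB ω x j).2⟩)]
  congr 1
  funext ω
  rw [sum_sum_mul_eq_mixture θ _ fun x =>
    lossEstimate θ (runState θ γ ℓ O t ω).prob x (ℓ t ω x) j]
  exact sum_mixture_mul_lossEstimate hθ (Exp4State.prob_mem _) _ (Exp4State.prob_pos _ j).ne'

theorem integral_sum_prob_mul_runEstimate [IsProbabilityMeasure μ] {t : ℕ} (ht : t < T) :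
    ∫ ω, ∑ i, (runState θ γ ℓ O t ω).prob i * runEstimate θ γ ℓ O t ω i ∂μ
      = ∫ ω, policyLoss θ (ℓ t ω) (ϑ t ω) ∂μ := by
  obtain ⟨B, hB0, hB⟩ := hrun.exists_estimate_mem hθ ht
  rw [hrun.integral_policyLoss_policy hθ ht,
    hrun.integral_apply_policy_outcome ht (f := fun _ x ω => ∑ i, (runState θ γ ℓ O t ω).prob i *
      lossEstimate θ (runState θ γ ℓ O t ω).prob x (ℓ t ω x) i) (B := B)]
  · congr 1
    funext ω
    rw [sum_sum_mul_eq_mixture θ _ fun x => ∑ i, (runState θ γ ℓ O t ω).prob i *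
      lossEstimate θ (runState θ γ ℓ O t ω).prob x (ℓ t ω x) i]
    simp only [Finset.mul_sum]
    rw [Finset.sum_comm]
    refine Finset.sum_congr rfl fun i _ => ?_
    rw [← sum_mixture_mul_lossEstimate hθ (Exp4State.prob_mem _) _
      (Exp4State.prob_pos (runState θ γ ℓ O t ω) i).ne', Finset.mul_sum]
    exact Finset.sum_congr rfl fun x _ => by ring
  · exact fun _ x => @Finset.measurable_fun_sum _ _ _ _ _ _ (_) _ _ fun i _ =>
      Measurable.mul (((measurable_runState_history (ϑ := ϑ) θ γ t).1 i).mono le_sup_right le_rfl)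
        (measurable_estimate_sigma ht x i)
  · intro _ x ω
    have hp := (runState θ γ ℓ O t ω).prob_mem
    rw [abs_of_nonneg (Finset.sum_nonneg fun i _ => mul_nonneg (hp.1 i) (hB ω x i).1)]
    calc _ ≤ ∑ i, (runState θ γ ℓ O t ω).prob i * B :=
          Finset.sum_le_sum fun i _ => mul_le_mul_of_nonneg_left (hB ω x i).2 (hp.1 i)
      _ = B := by rw [← Finset.sum_mul, hp.2, one_mul]

theorem abs_sum_prob_mul_sq_le {t : ℕ} (ht : t < T) : ∃ B : ℝ, ∀ ω x,
    |∑ i, (runState θ γ ℓ O t ω).prob i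
      * (lossEstimate θ (runState θ γ ℓ O t ω).prob x (ℓ t ω x) i - ℓ t ω x) ^ 2| ≤ B := by
  obtain ⟨B, hB0, hB⟩ := hrun.exists_estimate_mem hθ ht
  refine ⟨(B + 1) ^ 2, fun ω x => ?_⟩
  have hp := (runState θ γ ℓ O t ω).prob_mem
  rw [abs_of_nonneg (Finset.sum_nonneg fun i _ => mul_nonneg (hp.1 i) (sq_nonneg _))]
  calc _ ≤ ∑ i, (runState θ γ ℓ O t ω).prob i * (B + 1) ^ 2 := by
        refine Finset.sum_le_sum fun i _ => mul_le_mul_of_nonneg_left ?_ (hp.1 i)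
        have h1 := hB ω x i
        have h2 := hrun.loss_mem t ht ω x
        exact sq_le_sq' (by linarith [h1.1, h2.2]) (by linarith [h1.2, h2.1])
    _ = (B + 1) ^ 2 := by rw [← Finset.sum_mul, hp.2, one_mul]

/-- The rate is fixed by the history, and the outcome has conditional law the mixture of the current
distribution, whose recentred second moment the capacity bounds. -/
theorem integral_stability_le [IsProbabilityMeasure μ] {t : ℕ} (ht : t < T) :
    ∫ ω, (runState θ γ ℓ O t ω).rate * ∑ i, (runState θ γ ℓ O t ω).prob i
        * (runEstimate θ γ ℓ O t ω i - ℓ t ω (O t ω)) ^ 2 ∂μ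
      ≤ capacity θ * ∫ ω, (runState θ γ ℓ O t ω).rate ∂μ := by
  obtain ⟨B, hB⟩ := hrun.abs_sum_prob_mul_sq_le hθ ht
  have hr1 : ∀ ω, |(runState θ γ ℓ O t ω).rate| ≤ 1 := fun ω =>
    abs_le.2 ⟨by linarith [(runState θ γ ℓ O t ω).rate_nonneg], Exp4State.rate_le_one _⟩
  have hbound : ∀ ω x, |(runState θ γ ℓ O t ω).rate * ∑ i, (runState θ γ ℓ O t ω).prob i
      * (lossEstimate θ (runState θ γ ℓ O t ω).prob x (ℓ t ω x) i - ℓ t ω x) ^ 2| ≤ B := by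
    intro ω x
    rw [abs_mul]
    exact (mul_le_of_le_one_left (abs_nonneg _) (hr1 ω)).trans (hB ω x)
  rw [hrun.integral_apply_policy_outcome ht (f := fun _ x ω =>
      (runState θ γ ℓ O t ω).rate * ∑ i, (runState θ γ ℓ O t ω).prob i *
      (lossEstimate θ (runState θ γ ℓ O t ω).prob x (ℓ t ω x) i - ℓ t ω x) ^ 2) (B := B)
      ?_ (fun _ x ω => hbound ω x), ← integral_const_mul]
  · refine integral_mono_of_nonneg (Filter.Eventually.of_forall fun ω => ?_) ?_
      (Filter.Eventually.of_forall fun ω => ?_)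
    · have hp := (runState θ γ ℓ O t ω).prob_mem
      exact Finset.sum_nonneg fun i _ => Finset.sum_nonneg fun x _ =>
        mul_nonneg (mul_nonneg (hp.1 i) ((hθ i).1 x)) (mul_nonneg (Exp4State.rate_nonneg _)
          (Finset.sum_nonneg fun j _ => mul_nonneg (hp.1 j) (sq_nonneg _)))
    · exact (Integrable.of_bound (hrun.measurable_rate ht.le).aestronglyMeasurable 1
        (Filter.Eventually.of_forall hr1)).const_mul _
    · beta_reduce
      rw [sum_sum_mul_eq_mixture θ _ fun x =>
        (runState θ γ ℓ O t ω).rate * ∑ i, (runState θ γ ℓ O t ω).prob i *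
          (lossEstimate θ (runState θ γ ℓ O t ω).prob x (ℓ t ω x) i - ℓ t ω x) ^ 2]
      have h := mul_le_mul_of_nonneg_left (sum_mixture_mul_sq_le_capacity hθ
        (runState θ γ ℓ O t ω).prob_mem (hrun.loss_mem t ht ω))
        (runState θ γ ℓ O t ω).rate_nonneg
      rw [Finset.mul_sum] at h
      rw [mul_comm (capacity θ)]
      refine le_trans (le_of_eq (Finset.sum_congr rfl fun x _ => ?_)) h
      ring
  · intro _ x
    have hp := fun i => ((measurable_runState_history (ℓ := ℓ) (ϑ := ϑ) (O := O) θ γ t).1 i).mono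
      (le_sup_right (a := lossSigma ℓ T)) le_rfl
    have hr := (measurable_runState_history (ℓ := ℓ) (ϑ := ϑ) (O := O) θ γ t).2.mono
      (le_sup_right (a := lossSigma ℓ T)) le_rfl
    have hy : Measurable[lossSigma ℓ T ⊔ historySigma ℓ ϑ O t] fun ω => ℓ t ω x :=
      (measurable_pi_apply x).comp ((measurable_loss_lossSigma ht).mono le_sup_left le_rfl)
    have he := fun i => measurable_estimate_sigma (θ := θ) (γ := γ) (ℓ := ℓ) (ϑ := ϑ) (O := O) ht x i
    exact hr.mul (@Finset.measurable_fun_sum _ _ _ _ _ _ (_) _ _ fun i _ =>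
      (hp i).mul (((he i).sub hy).pow_const 2))

end IsExp4Run

end Run

theorem capacity_nonneg {N K : ℕ} [NeZero N] {θ : Fin N → Fin K → ℝ}
    (hθ : ∀ i, θ i ∈ stdSimplex ℝ (Fin K)) : 0 ≤ capacity θ := by
  have hp := (Exp4State.init N 0).prob_mem
  refine le_trans ?_ (le_csSup (bddAbove_chiSqInfo hθ) ⟨_, hp, rfl⟩)
  exact Finset.sum_nonneg fun i _ => mul_nonneg (hp.1 i) (Finset.sum_nonneg fun x _ =>
    mul_nonneg (Finset.sum_nonneg fun j _ => mul_nonneg (hp.1 j) ((hθ j).1 x)) (sq_nonneg _))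

theorem one_le_log_exp_one_mul {T : ℕ} (hT : 1 ≤ T) : 1 ≤ Real.log (Real.exp 1 * T) := by
  have hT' : (1 : ℝ) ≤ T := by exact_mod_cast hT
  rw [Real.log_mul (Real.exp_pos 1).ne' (by positivity), Real.log_exp]
  linarith [Real.log_nonneg hT']

/-! ### Expected entropy and expected regret -/

section Run

variable {Ω : Type*} [MeasurableSpace Ω] {μ : Measure Ω} {N K T : ℕ}
  {θ : Fin N → Fin K → ℝ} {γ : ℝ} {ℓ : ℕ → Ω → Fin K → ℝ} {ϑ : ℕ → Ω → Fin N} {O : ℕ → Ω → Fin K}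

namespace IsExp4Run

variable (hrun : IsExp4Run μ θ γ T ℓ ϑ O)
include hrun

theorem measurable_cumEntropy :
    Measurable fun ω => (runState θ γ ℓ O T ω).cumEntropy :=
  (measurable_exp4State θ γ (obs := fun ω s => (O s ω, ℓ s ω (O s ω)))
    (fun s hs => (hrun.measurable_outcome s hs).prodMk (hrun.measurable_observed hs))).2.2

theorem integrable_prob_mul [NeZero N] {t : ℕ} (ht : t ≤ T) (i : Fin N) {f : Ω → ℝ} (hf : Integrable f μ) :
    Integrable (fun ω => (runState θ γ ℓ O t ω).prob i * f ω) μ := by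
  refine hf.bdd_mul (c := 1) (hrun.measurable_prob ht i).aestronglyMeasurable
    (Filter.Eventually.of_forall fun ω => ?_)
  have hp := (runState θ γ ℓ O t ω).prob_mem
  rw [Real.norm_of_nonneg (hp.1 i), ← hp.2]
  exact Finset.single_le_sum (fun y _ => hp.1 y) (Finset.mem_univ i)

variable [IsProbabilityMeasure μ]

theorem integrable_cumEntropy [NeZero N] :
    Integrable (fun ω => (runState θ γ ℓ O T ω).cumEntropy) μ := by
  refine Integrable.of_bound hrun.measurable_cumEntropy.aestronglyMeasurable (T * Real.log N)
    (Filter.Eventually.of_forall fun ω => ?_)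
  rw [Real.norm_of_nonneg (cumEntropy_nonneg _ _ _ _), cumEntropy_eq_sum]
  refine (Finset.sum_le_sum fun s _ => shannonEntropy_le_log (Exp4State.prob_mem _)).trans_eq ?_
  simp

theorem integral_cumEntropy_le [NeZero N] :
    ∫ ω, (runState θ γ ℓ O T ω).cumEntropy ∂μ ≤ T * Real.log N := by
  have h : ∀ ω, (runState θ γ ℓ O T ω).cumEntropy ≤ T * Real.log N := by
    intro ω
    rw [cumEntropy_eq_sum]
    refine (Finset.sum_le_sum fun s _ => shannonEntropy_le_log (Exp4State.prob_mem _)).trans_eq ?_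
    simp
  simpa using integral_mono hrun.integrable_cumEntropy (integrable_const _) h

theorem integrable_prob [NeZero N] {t : ℕ} (ht : t ≤ T) (i : Fin N) :
    Integrable (fun ω => (runState θ γ ℓ O t ω).prob i) μ := by
  refine Integrable.of_bound (hrun.measurable_prob ht i).aestronglyMeasurable 1
    (Filter.Eventually.of_forall fun ω => ?_)
  have hp := (runState θ γ ℓ O t ω).prob_mem
  rw [Real.norm_of_nonneg (hp.1 i), ← hp.2]
  exact Finset.single_le_sum (fun y _ => hp.1 y) (Finset.mem_univ i)

theorem integral_cumEntropy_le_of_mass [NeZero N] (hT : 1 ≤ T) (k : Fin N) :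
    ∫ ω, (runState θ γ ℓ O T ω).cumEntropy ∂μ ≤ 1 + Real.log ((N : ℝ) * T) *
      ∑ t ∈ Finset.range T, ∫ ω, (1 - (runState θ γ ℓ O t ω).prob k) ∂μ := by
  have hN : (0 : ℝ) < N := by exact_mod_cast Nat.pos_of_ne_zero (NeZero.ne N)
  have hT' : (0 : ℝ) < T := by exact_mod_cast hT
  have h : ∀ ω, (runState θ γ ℓ O T ω).cumEntropy ≤ 1 + Real.log ((N : ℝ) * T) *
      ∑ t ∈ Finset.range T, (1 - (runState θ γ ℓ O t ω).prob k) := by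
    intro ω
    rw [cumEntropy_eq_sum]
    refine (Finset.sum_le_sum fun s _ => shannonEntropy_le_of_mass (Exp4State.prob_mem _) k
      (Real.log ((N : ℝ) * T))).trans_eq ?_
    rw [Finset.sum_add_distrib, Finset.mul_sum, Real.exp_neg, Real.exp_log (by positivity)]
    simp only [Finset.sum_const, Finset.card_range, nsmul_eq_mul]
    congr 1
    field_simp
  have hint : ∀ t ∈ Finset.range T,
      Integrable (fun ω => 1 - (runState θ γ ℓ O t ω).prob k) μ := fun t ht =>
    (integrable_const 1).sub (hrun.integrable_prob (Finset.mem_range.1 ht).le k)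
  refine (integral_mono hrun.integrable_cumEntropy ((integrable_const 1).add
    ((integrable_finsetSum _ hint).const_mul _)) h).trans_eq ?_
  simp only [Pi.add_apply]
  rw [integral_add (integrable_const 1) ((integrable_finsetSum _ hint).const_mul _),
    integral_const_mul, integral_finsetSum _ hint]
  simp

variable (hθ : ∀ i, θ i ∈ stdSimplex ℝ (Fin K))
include hθ

theorem integrable_policyLoss {t : ℕ} (ht : t < T) (i : Fin N) :
    Integrable (fun ω => policyLoss θ (ℓ t ω) i) μ := by
  refine Integrable.of_bound
    (measurable_policyLoss (hrun.measurable_loss t ht) i).aestronglyMeasurable 1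
    (Filter.Eventually.of_forall fun ω => ?_)
  have := policyLoss_mem hθ (hrun.loss_mem t ht ω) i
  rw [Real.norm_of_nonneg this.1]
  exact this.2

theorem integrable_policyLoss_policy {t : ℕ} (ht : t < T) :
    Integrable (fun ω => policyLoss θ (ℓ t ω) (ϑ t ω)) μ := by
  refine Integrable.of_bound (hrun.measurable_apply_policy_outcome ht
    (f := fun i _ ω => policyLoss θ (ℓ t ω) i)
    (fun i _ => measurable_policyLoss (hrun.measurable_loss t ht) i)).aestronglyMeasurable 1
    (Filter.Eventually.of_forall fun ω => ?_)
  have := policyLoss_mem hθ (hrun.loss_mem t ht ω) (ϑ t ω)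
  rw [Real.norm_of_nonneg this.1]
  exact this.2

theorem le_regret (k : Fin N) : ∑ t ∈ Finset.range T,
      (∫ ω, policyLoss θ (ℓ t ω) (ϑ t ω) ∂μ - ∫ ω, policyLoss θ (ℓ t ω) k ∂μ)
    ≤ regret μ θ T ℓ ϑ := by
  have := ciInf_le (Set.finite_range
    fun i : Fin N => ∫ ω, ∑ t ∈ Finset.range T, policyLoss θ (ℓ t ω) i ∂μ).bddBelow k
  rw [integral_finsetSum _ fun t ht =>
    hrun.integrable_policyLoss hθ (Finset.mem_range.1 ht) k] at this
  rw [regret, integral_finsetSum _ fun t ht =>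
      hrun.integrable_policyLoss_policy hθ (Finset.mem_range.1 ht), Finset.sum_sub_distrib]
  linarith

variable [NeZero N]

theorem exists_regret_eq :
    ∃ j, regret μ θ T ℓ ϑ = ∑ t ∈ Finset.range T,
      (∫ ω, policyLoss θ (ℓ t ω) (ϑ t ω) ∂μ - ∫ ω, policyLoss θ (ℓ t ω) j ∂μ) := by
  obtain ⟨j, hj⟩ := exists_eq_ciInf_of_finite
    (f := fun i : Fin N => ∫ ω, ∑ t ∈ Finset.range T, policyLoss θ (ℓ t ω) i ∂μ)
  refine ⟨j, ?_⟩
  rw [regret, ← hj, integral_finsetSum _ fun t ht =>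
      hrun.integrable_policyLoss_policy hθ (Finset.mem_range.1 ht),
    integral_finsetSum _ fun t ht => hrun.integrable_policyLoss hθ (Finset.mem_range.1 ht) j,
    Finset.sum_sub_distrib]

theorem integrable_runEstimate {t : ℕ} (ht : t < T) (i : Fin N) :
    Integrable (fun ω => runEstimate θ γ ℓ O t ω i) μ := by
  obtain ⟨B, hB0, hB⟩ := hrun.exists_estimate_mem hθ ht
  refine Integrable.of_bound (hrun.measurable_runEstimate ht i).aestronglyMeasurable B
    (Filter.Eventually.of_forall fun ω => ?_)
  rw [Real.norm_of_nonneg (hB ω _ i).1]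
  exact (hB ω _ i).2

theorem integrable_stability {t : ℕ} (ht : t < T) :
    Integrable (fun ω => (runState θ γ ℓ O t ω).rate * ∑ i, (runState θ γ ℓ O t ω).prob i
        * (runEstimate θ γ ℓ O t ω i - ℓ t ω (O t ω)) ^ 2) μ := by
  obtain ⟨B, hB⟩ := hrun.abs_sum_prob_mul_sq_le hθ ht
  refine Integrable.of_bound ((hrun.measurable_rate ht.le).mul
    (Finset.measurable_fun_sum _ fun i _ => (hrun.measurable_prob ht.le i).mul
      (((hrun.measurable_runEstimate ht i).sub
        (hrun.measurable_observed ht)).pow_const 2))).aestronglyMeasurable B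
    (Filter.Eventually.of_forall fun ω => ?_)
  rw [norm_mul, Real.norm_of_nonneg (Exp4State.rate_nonneg _)]
  exact (mul_le_of_le_one_left (norm_nonneg _) (Exp4State.rate_le_one _)).trans (hB ω _)

/-- The regret against any policy is bounded in terms of the expected cumulative entropy. -/
theorem sum_integral_policyLoss_sub_le (hN : 2 ≤ N) (hT : 1 ≤ T) (hγ : 0 ≤ γ)
    (hC : γ ^ 2 * Real.log N = Real.exp 1 / 2 * capacity θ * Real.log (Real.exp 1 * T))
    (j : Fin N) :
    ∑ t ∈ Finset.range T,
        (∫ ω, policyLoss θ (ℓ t ω) (ϑ t ω) ∂μ - ∫ ω, policyLoss θ (ℓ t ω) j ∂μ)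
      ≤ Real.log N + 3 * √(Real.exp 1 / 2 * capacity θ * Real.log (Real.exp 1 * T) *
          ∫ ω, (runState θ γ ℓ O T ω).cumEntropy ∂μ) := by
  have hlog : 0 < Real.log N := Real.log_pos (by exact_mod_cast hN)
  -- There are `T` rounds but only `T - 1` rate changes to pay for.
  obtain ⟨n, rfl⟩ : ∃ n, T = n + 1 := ⟨T - 1, by omega⟩
  -- The true stability term is kept next to its capacity bound: their difference need not be
  -- nonnegative on a trajectory, only in expectation.
  have hpath : ∀ ω, ∑ t ∈ Finset.range (n + 1),
      (∑ i, (runState θ γ ℓ O t ω).prob i * runEstimate θ γ ℓ O t ω i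
        - runEstimate θ γ ℓ O t ω j
        + Real.exp 1 / 2 * (capacity θ * (runState θ γ ℓ O t ω).rate
          - (runState θ γ ℓ O t ω).rate * ∑ i, (runState θ γ ℓ O t ω).prob i
            * (runEstimate θ γ ℓ O t ω i - ℓ t ω (O t ω)) ^ 2))
      ≤ Real.log N + 3 * γ * Real.log N *
        √(1 / Real.log N * (runState θ γ ℓ O (n + 1) ω).cumEntropy) := by
    intro ω
    have h1 := sum_prob_mul_lossEstimate_le_softMin θ γ (fun s => (O s ω, ℓ s ω (O s ω))) hθ n
      (fun t ht => hrun.obs_mem le_rfl ω t (by omega))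
    have h2 := penalty_add_stability_le θ γ (fun s => (O s ω, ℓ s ω (O s ω))) hN hγ hC
    have h3 := softMin_le_apply
      (b := max 1 (exp4State θ γ (fun s => (O s ω, ℓ s ω (O s ω))) n).β)
      (lt_of_lt_of_le one_pos (le_max_left _ _))
      (exp4State θ γ (fun s => (O s ω, ℓ s ω (O s ω))) (n + 1)).cumLoss j
    rw [cumLoss_eq_sum] at h3
    have h4 : ∀ t ∈ Finset.range (n + 1),
        (∑ i, (runState θ γ ℓ O t ω).prob i * runEstimate θ γ ℓ O t ω i
          - runEstimate θ γ ℓ O t ω j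
          + Real.exp 1 / 2 * (capacity θ * (runState θ γ ℓ O t ω).rate
            - (runState θ γ ℓ O t ω).rate * ∑ i, (runState θ γ ℓ O t ω).prob i
              * (runEstimate θ γ ℓ O t ω i - ℓ t ω (O t ω)) ^ 2))
        = (∑ i, (runState θ γ ℓ O t ω).prob i * runEstimate θ γ ℓ O t ω i
          - Real.exp 1 / 2 * (runState θ γ ℓ O t ω).rate * ∑ i, (runState θ γ ℓ O t ω).prob i
              * (runEstimate θ γ ℓ O t ω i - ℓ t ω (O t ω)) ^ 2)
          - runEstimate θ γ ℓ O t ω j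
          + Real.exp 1 / 2 * capacity θ * (runState θ γ ℓ O t ω).rate := by
      intro t _; ring
    rw [Finset.sum_congr rfl h4, Finset.sum_add_distrib, Finset.sum_sub_distrib,
      ← Finset.mul_sum]
    linarith
  set A : Ω → ℝ := fun ω => 1 / Real.log N * (runState θ γ ℓ O (n + 1) ω).cumEntropy with hA
  have hA0 : ∀ ω, 0 ≤ A ω := fun ω =>
    mul_nonneg (one_div_nonneg.2 hlog.le) (cumEntropy_nonneg _ _ _ _)
  have hAint : Integrable A μ := hrun.integrable_cumEntropy.const_mul _
  have hsint : Integrable (fun ω => √(A ω)) μ := by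
    refine (hAint.add (integrable_const 1)).mono'
      (hrun.measurable_cumEntropy.const_mul _).sqrt.aestronglyMeasurable
      (Filter.Eventually.of_forall fun ω => ?_)
    rw [Real.norm_of_nonneg (Real.sqrt_nonneg _), Pi.add_apply]
    nlinarith [Real.sq_sqrt (hA0 ω), sq_nonneg (√(A ω) - 1), Real.sqrt_nonneg (A ω)]
  have hjensen : ∫ ω, √(A ω) ∂μ ≤ √(∫ ω, A ω ∂μ) :=
    Real.strictConcaveOn_sqrt.concaveOn.le_map_integral Real.continuous_sqrt.continuousOn isClosed_Ici
      (Filter.Eventually.of_forall hA0) hAint hsint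
  have hrate : ∀ t < n + 1, Integrable (fun ω => (runState θ γ ℓ O t ω).rate) μ := fun t ht =>
    Integrable.of_bound (hrun.measurable_rate ht.le).aestronglyMeasurable 1
      (Filter.Eventually.of_forall fun ω => by
        rw [Real.norm_of_nonneg (Exp4State.rate_nonneg _)]; exact Exp4State.rate_le_one _)
  have hint1 : ∀ t < n + 1, Integrable (fun ω =>
      ∑ i, (runState θ γ ℓ O t ω).prob i * runEstimate θ γ ℓ O t ω i) μ := fun t ht =>
    integrable_finsetSum _ fun i _ =>
      hrun.integrable_prob_mul ht.le i (hrun.integrable_runEstimate hθ ht i)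
  have hint2 : ∀ t < n + 1, Integrable (fun ω =>
      Real.exp 1 / 2 * (capacity θ * (runState θ γ ℓ O t ω).rate
          - (runState θ γ ℓ O t ω).rate * ∑ i, (runState θ γ ℓ O t ω).prob i
            * (runEstimate θ γ ℓ O t ω i - ℓ t ω (O t ω)) ^ 2)) μ := fun t ht =>
    (((hrate t ht).const_mul _).sub (hrun.integrable_stability hθ ht)).const_mul _
  have hint3 : ∀ t < n + 1, Integrable (fun ω =>
      ∑ i, (runState θ γ ℓ O t ω).prob i * runEstimate θ γ ℓ O t ω i
        - runEstimate θ γ ℓ O t ω j) μ := fun t ht =>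
    (hint1 t ht).sub (hrun.integrable_runEstimate hθ ht j)
  have hint4 : ∀ t ∈ Finset.range (n + 1), Integrable (fun ω =>
      ∑ i, (runState θ γ ℓ O t ω).prob i * runEstimate θ γ ℓ O t ω i
        - runEstimate θ γ ℓ O t ω j
        + Real.exp 1 / 2 * (capacity θ * (runState θ γ ℓ O t ω).rate
          - (runState θ γ ℓ O t ω).rate * ∑ i, (runState θ γ ℓ O t ω).prob i
            * (runEstimate θ γ ℓ O t ω i - ℓ t ω (O t ω)) ^ 2)) μ := fun t ht =>
    (hint3 t (Finset.mem_range.1 ht)).add (hint2 t (Finset.mem_range.1 ht))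
  have hmono := integral_mono (integrable_finsetSum _ hint4)
    ((integrable_const (Real.log N)).add (hsint.const_mul (3 * γ * Real.log N))) hpath
  simp only [Pi.add_apply] at hmono
  rw [integral_finsetSum _ hint4, integral_add (integrable_const _) (hsint.const_mul _), integral_const_mul] at hmono
  have hterm : ∀ t ∈ Finset.range (n + 1),
      ∫ ω, policyLoss θ (ℓ t ω) (ϑ t ω) ∂μ - ∫ ω, policyLoss θ (ℓ t ω) j ∂μ
      ≤ ∫ ω, (∑ i, (runState θ γ ℓ O t ω).prob i * runEstimate θ γ ℓ O t ω i
        - runEstimate θ γ ℓ O t ω j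
        + Real.exp 1 / 2 * (capacity θ * (runState θ γ ℓ O t ω).rate
          - (runState θ γ ℓ O t ω).rate * ∑ i, (runState θ γ ℓ O t ω).prob i
            * (runEstimate θ γ ℓ O t ω i - ℓ t ω (O t ω)) ^ 2)) ∂μ := by
    intro t ht
    have ht := Finset.mem_range.1 ht
    rw [integral_add (hint3 t ht) (hint2 t ht),
      integral_sub (hint1 t ht) (hrun.integrable_runEstimate hθ ht j), integral_const_mul,
      integral_sub ((hrate t ht).const_mul _) (hrun.integrable_stability hθ ht),
      integral_const_mul, hrun.integral_runEstimate hθ ht,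
      hrun.integral_sum_prob_mul_runEstimate hθ ht]
    have h1 := hrun.integral_stability_le hθ ht
    have h2 : 0 ≤ Real.exp 1 / 2 * (capacity θ * ∫ ω, (runState θ γ ℓ O t ω).rate ∂μ
        - ∫ ω, (runState θ γ ℓ O t ω).rate * ∑ i, (runState θ γ ℓ O t ω).prob i
            * (runEstimate θ γ ℓ O t ω i - ℓ t ω (O t ω)) ^ 2 ∂μ) :=
      mul_nonneg (by positivity) (sub_nonneg.2 h1)
    linarith
  refine (Finset.sum_le_sum hterm).trans (hmono.trans ?_)
  have hEA : ∫ ω, A ω ∂μ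
      = 1 / Real.log N * ∫ ω, (runState θ γ ℓ O (n + 1) ω).cumEntropy ∂μ :=
    integral_const_mul _ _
  set E := ∫ ω, (runState θ γ ℓ O (n + 1) ω).cumEntropy ∂μ
  have h5 : Real.exp 1 / 2 * capacity θ * Real.log (Real.exp 1 * (n + 1 : ℕ)) * E
      = (γ * Real.log N) ^ 2 * (1 / Real.log N * E) := by
    rw [← hC]; field_simp
  rw [h5, Real.sqrt_mul (sq_nonneg _), Real.sqrt_sq (mul_nonneg hγ hlog.le), ← hEA]
  have h6 := mul_le_mul_of_nonneg_left hjensen (mul_nonneg (mul_nonneg zero_le_three hγ) hlog.le)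
  simp only [integral_const, probReal_univ, one_smul]
  linarith

/-- In the corrupted stochastic regime the regret against the optimal policy controls the
probability of the suboptimal policies. -/
theorem gap_mul_sum_sub_le {k : Fin N} {Δ : ℝ} {c : ℕ → ℝ}
    (hcor : IsCorruptedStochastic μ θ T ℓ ϑ O k Δ c) :
    Δ * ∑ t ∈ Finset.range T, ∫ ω, (1 - (runState θ γ ℓ O t ω).prob k) ∂μ
        - ∑ t ∈ Finset.range T, c t
      ≤ ∑ t ∈ Finset.range T,
        (∫ ω, policyLoss θ (ℓ t ω) (ϑ t ω) ∂μ - ∫ ω, policyLoss θ (ℓ t ω) k ∂μ) := by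
  rw [Finset.mul_sum, ← Finset.sum_sub_distrib]
  refine Finset.sum_le_sum fun t ht => ?_
  have ht := Finset.mem_range.1 ht
  have hD : ∀ i, Integrable (fun ω => policyLoss θ (ℓ t ω) i - policyLoss θ (ℓ t ω) k) μ :=
    fun i => (hrun.integrable_policyLoss hθ ht i).sub (hrun.integrable_policyLoss hθ ht k)
  have hpD : ∀ i, Integrable (fun ω => (runState θ γ ℓ O t ω).prob i *
      (policyLoss θ (ℓ t ω) i - policyLoss θ (ℓ t ω) k)) μ :=
    fun i => hrun.integrable_prob_mul ht.le i (hD i)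
  have hp := fun i => hrun.integrable_prob ht.le i
  have heq : ∫ ω, policyLoss θ (ℓ t ω) (ϑ t ω) ∂μ - ∫ ω, policyLoss θ (ℓ t ω) k ∂μ
      = ∑ i, ∫ ω, (runState θ γ ℓ O t ω).prob i *
        (policyLoss θ (ℓ t ω) i - policyLoss θ (ℓ t ω) k) ∂μ := by
    rw [hrun.integral_policyLoss_policy hθ ht, ← integral_finsetSum _ fun i _ => hpD i,
      ← integral_sub (integrable_finsetSum _ fun i _ => hrun.integrable_prob_mul ht.le i
        (hrun.integrable_policyLoss hθ ht i)) (hrun.integrable_policyLoss hθ ht k)]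
    congr 1
    funext ω
    simp only [mul_sub, Finset.sum_sub_distrib, ← Finset.sum_mul,
      (runState θ γ ℓ O t ω).prob_mem.2, one_mul]
  have hterm : ∀ i, i ≠ k → (Δ - c t) * ∫ ω, (runState θ γ ℓ O t ω).prob i ∂μ
      ≤ ∫ ω, (runState θ γ ℓ O t ω).prob i *
        (policyLoss θ (ℓ t ω) i - policyLoss θ (ℓ t ω) k) ∂μ := by
    intro i hi
    -- The gap holds only conditionally on the history; the weight `p_t(i)` is history-measurable
    -- and positive, so it multiplies the conditional inequality.
    have hm := hrun.historySigma_le ht.le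
    have hpull := condExp_mul_of_stronglyMeasurable_left
      ((measurable_runState_history (ϑ := ϑ) θ γ t).1 i).stronglyMeasurable (hpD i) (hD i)
    rw [← integral_condExp hm (f := fun ω => (runState θ γ ℓ O t ω).prob i *
        (policyLoss θ (ℓ t ω) i - policyLoss θ (ℓ t ω) k)), ← integral_const_mul]
    refine integral_mono_ae ((hp i).const_mul _) integrable_condExp ?_
    filter_upwards [hpull, hcor.gap t ht i hi] with ω h1 h2
    refine le_of_le_of_eq ?_ h1.symm
    rw [Pi.mul_apply, mul_comm]
    exact mul_le_mul_of_nonneg_left h2 (Exp4State.prob_pos _ i).le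
  have hmass : ∫ ω, (1 - (runState θ γ ℓ O t ω).prob k) ∂μ
      = ∑ i ∈ Finset.univ.erase k, ∫ ω, (runState θ γ ℓ O t ω).prob i ∂μ := by
    rw [← integral_finsetSum _ fun i _ => hp i]
    congr 1
    funext ω
    rw [← (runState θ γ ℓ O t ω).prob_mem.2, ← Finset.add_sum_erase _ _ (Finset.mem_univ k)]
    ring
  have hle : (Δ - c t) * ∫ ω, (1 - (runState θ γ ℓ O t ω).prob k) ∂μ
      ≤ ∫ ω, policyLoss θ (ℓ t ω) (ϑ t ω) ∂μ - ∫ ω, policyLoss θ (ℓ t ω) k ∂μ := by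
    rw [heq, hmass, Finset.mul_sum, ← Finset.add_sum_erase _ _ (Finset.mem_univ k)]
    simp only [sub_self, mul_zero, integral_zero, zero_add]
    exact Finset.sum_le_sum fun i hi => hterm i (Finset.ne_of_mem_erase hi)
  have hone : ∫ ω, (1 - (runState θ γ ℓ O t ω).prob k) ∂μ ≤ 1 := by
    have := integral_mono ((integrable_const 1).sub (hp k)) (integrable_const (1 : ℝ))
      fun ω => sub_le_self _ (Exp4State.prob_pos (runState θ γ ℓ O t ω) k).le
    simpa using this
  -- The suboptimal mass is at most `1`, so it can be dropped from the corruption term.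
  nlinarith [mul_le_mul_of_nonneg_left hone (hcor.corruption_nonneg t ht)]

end IsExp4Run

end Run

/-! ### Self-bounding inequality and conclusion -/

theorem Real.sqrt_add_le_sqrt_add_sqrt {x y : ℝ} (hx : 0 ≤ x) (hy : 0 ≤ y) :
    √(x + y) ≤ √x + √y := by
  rw [Real.sqrt_le_left (by positivity)]
  nlinarith [Real.sq_sqrt hx, Real.sq_sqrt hy, mul_nonneg (Real.sqrt_nonneg x) (Real.sqrt_nonneg y)]

/-- Solving the self-bounding inequality for the regret in the corrupted stochastic regime. -/
theorem regret_le_of_self_bounding {R S D B L Δ n : ℝ} (hB : 0 ≤ B) (hL : 1 / 2 ≤ L)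
    (hΔ : 0 < Δ) (hD : 0 ≤ D) (hn : 0 ≤ n)
    (h1 : R ≤ n + 3 * √(Real.exp 1 / 2 * B * (1 + L * S))) (h2 : Δ * S - D ≤ R) :
    R ≤ 36 * Real.exp 1 ^ 2 * (B * L / Δ) + 3 * Real.exp 1 * √(2 * B * L * D / Δ)
      + 2 * n + 4 * Δ := by
  have he : 2 ≤ Real.exp 1 := by linarith [Real.add_one_le_exp (1 : ℝ)]
  set e := Real.exp 1
  have hL0 : 0 ≤ L := by linarith
  -- From here on `R > 0`, so the square root splits into nonnegative pieces.
  rcases le_or_gt R 0 with hR | hR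
  · exact hR.trans (by positivity)
  have hS : S ≤ (R + D) / Δ := by rw [le_div_iff₀ hΔ]; linarith
  have hX : √(e / 2 * B * (1 + L * S))
      ≤ √(e / 2 * B) + √(e / 2 * B * L / Δ * R) + √(e / 2 * B * L * D / Δ) := by
    have h3 : e / 2 * B * (1 + L * S)
        ≤ e / 2 * B + (e / 2 * B * L / Δ * R + e / 2 * B * L * D / Δ) := by
      calc e / 2 * B * (1 + L * S) ≤ e / 2 * B * (1 + L * ((R + D) / Δ)) := by gcongr
        _ = _ := by field_simp
    refine (Real.sqrt_le_sqrt h3).trans ((Real.sqrt_add_le_sqrt_add_sqrt (by positivity) (by positivity)).trans ?_)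
    have := Real.sqrt_add_le_sqrt_add_sqrt (x := e / 2 * B * L / Δ * R)
      (y := e / 2 * B * L * D / Δ) (by positivity) (by positivity)
    linarith
  have amgm : ∀ x y : ℝ, 0 ≤ x → 0 ≤ y → √(x * y) ≤ (x + y) / 2 := by
    intro x y hx hy
    rw [Real.sqrt_mul hx]
    nlinarith [sq_nonneg (√x - √y), Real.sq_sqrt hx, Real.sq_sqrt hy]
  have h4 : √(e / 2 * B) ≤ (2 / 3 * Δ + 3 / 4 * (e * B / Δ)) / 2 := by
    have := amgm (2 / 3 * Δ) (3 / 4 * (e * B / Δ)) (by positivity) (by positivity)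
    have h : 2 / 3 * Δ * (3 / 4 * (e * B / Δ)) = e / 2 * B := by field_simp; ring
    rwa [h] at this
  -- The weights are chosen so that, after the factor `3`, the right side contains `R / 2`.
  -- Absorbing it on the left doubles all other terms, which is why `h6` carries a factor `2`.
  have h5 : √(e / 2 * B * L / Δ * R) ≤ (3 * (e / 2 * B * L / Δ) + R / 3) / 2 := by
    have := amgm (3 * (e / 2 * B * L / Δ)) (R / 3) (by positivity) (by positivity)
    have h : 3 * (e / 2 * B * L / Δ) * (R / 3) = e / 2 * B * L / Δ * R := by ring
    rwa [h] at this
  have h6 : 2 * √(e / 2 * B * L * D / Δ) ≤ e * √(2 * B * L * D / Δ) := by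
    have h : √(e / 2 * B * L * D / Δ) ≤ e / 2 * √(2 * B * L * D / Δ) := by
      rw [Real.sqrt_le_left (by positivity), mul_pow, Real.sq_sqrt (by positivity)]
      have : e / 2 * B * L * D / Δ * 1 ≤ e / 2 * B * L * D / Δ * e := by gcongr; linarith
      calc _ = e / 2 * B * L * D / Δ * 1 := by ring
        _ ≤ _ := this
        _ = _ := by ring
    linarith
  -- This uses `e * L ≥ 1`, the reason for assuming `L ≥ 1 / 2`.
  have h7 : e * B / Δ ≤ e ^ 2 * (B * L / Δ) := by
    have h : B / Δ * (e * 1) ≤ B / Δ * (e * (e * L)) := by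
      gcongr
      nlinarith
    calc _ = B / Δ * (e * 1) := by ring
      _ ≤ _ := h
      _ = _ := by ring
  have h8 : e / 2 * B * L / Δ ≤ e ^ 2 * (B * L / Δ) := by
    have h : B * L / Δ * (e / 2) ≤ B * L / Δ * e ^ 2 := by
      gcongr
      nlinarith
    calc _ = B * L / Δ * (e / 2) := by ring
      _ ≤ _ := h
      _ = _ := by ring
  have h9 : 0 ≤ e ^ 2 * (B * L / Δ) := by positivity
  linarith

theorem theorem3 {N K T : ℕ} (hN : 2 ≤ N) (hT : 1 ≤ T)
    (θ : Fin N → Fin K → ℝ) (hθ : ∀ i, θ i ∈ stdSimplex ℝ (Fin K))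
    {Ω : Type*} [MeasurableSpace Ω] (μ : Measure Ω) [IsProbabilityMeasure μ]
    (ℓ : ℕ → Ω → Fin K → ℝ) (ϑ : ℕ → Ω → Fin N) (O : ℕ → Ω → Fin K)
    (hrun : IsExp4Run μ θ (exp4Gamma θ T) T ℓ ϑ O) :
    regret μ θ T ℓ ϑ ≤
        3 * √(2 * Real.exp 1 * capacity θ * T * Real.log (Real.exp 1 * T) *
          Real.log (Real.exp 1 * N)) + Real.log N ∧
      ∀ (iStar : Fin N) (Δ : ℝ) (c : ℕ → ℝ),
        IsCorruptedStochastic μ θ T ℓ ϑ O iStar Δ c →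
        regret μ θ T ℓ ϑ ≤
          36 * Real.exp 1 ^ 2 *
              (capacity θ * Real.log (Real.exp 1 * T) * Real.log ((N : ℝ) * T) / Δ) +
            3 * Real.exp 1 *
              √(2 * capacity θ * Real.log (Real.exp 1 * T) * Real.log ((N : ℝ) * T) *
                (∑ t ∈ Finset.range T, c t) / Δ) +
            2 * Real.log N + 4 * Δ := by
  have : NeZero N := ⟨by omega⟩
  have hN' : (2 : ℝ) ≤ N := by exact_mod_cast hN
  have hT' : (1 : ℝ) ≤ T := by exact_mod_cast hT
  have hlog : 0 < Real.log N := Real.log_pos (by linarith)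
  have hlogT : 1 ≤ Real.log (Real.exp 1 * T) := one_le_log_exp_one_mul hT
  have hlogT0 : 0 < Real.log (Real.exp 1 * T) := by linarith
  have hlogeN : 0 < Real.log (Real.exp 1 * N) := by
    linarith [one_le_log_exp_one_mul (T := N) (by omega)]
  have hcap : 0 ≤ capacity θ := capacity_nonneg hθ
  have hγ : 0 ≤ exp4Gamma θ T := Real.sqrt_nonneg _
  have hC : exp4Gamma θ T ^ 2 * Real.log N
      = Real.exp 1 / 2 * capacity θ * Real.log (Real.exp 1 * T) := by
    rw [exp4Gamma, Real.sq_sqrt (by positivity)]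
    field_simp
  obtain ⟨j, hj⟩ := hrun.exists_regret_eq hθ
  have hreg := hrun.sum_integral_policyLoss_sub_le hθ hN hT hγ hC j
  rw [← hj] at hreg
  constructor
  · have h1 : √(Real.exp 1 / 2 * capacity θ * Real.log (Real.exp 1 * T) *
          ∫ ω, (runState θ (exp4Gamma θ T) ℓ O T ω).cumEntropy ∂μ)
        ≤ √(2 * Real.exp 1 * capacity θ * T * Real.log (Real.exp 1 * T) *
          Real.log (Real.exp 1 * N)) := by
      refine Real.sqrt_le_sqrt ?_
      have h2 : Real.log N ≤ Real.log (Real.exp 1 * N) := by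
        rw [Real.log_mul (Real.exp_pos 1).ne' (by positivity), Real.log_exp]
        linarith
      have h3 : ∫ ω, (runState θ (exp4Gamma θ T) ℓ O T ω).cumEntropy ∂μ
          ≤ T * Real.log (Real.exp 1 * N) :=
        hrun.integral_cumEntropy_le.trans (by gcongr)
      calc _ ≤ Real.exp 1 / 2 * capacity θ * Real.log (Real.exp 1 * T) *
            (T * Real.log (Real.exp 1 * N)) := by gcongr
        -- The argument leaves a spare factor `4` under the root.
        _ = 1 / 4 * (2 * Real.exp 1 * capacity θ * T * Real.log (Real.exp 1 * T) *
            Real.log (Real.exp 1 * N)) := by ring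
        _ ≤ _ := mul_le_of_le_one_left (by positivity) (by norm_num)
    linarith
  · intro k Δ c hcor
    have hL : 1 / 2 ≤ Real.log ((N : ℝ) * T) := by
      have h1 : Real.log 2 ≤ Real.log ((N : ℝ) * T) :=
        Real.log_le_log (by norm_num) (by nlinarith)
      linarith [Real.log_two_gt_d9]
    -- The regret is at least the excess loss over `k`, so `k` need not be the minimiser in the
    -- definition of regret.
    have hlow := (hrun.gap_mul_sum_sub_le hθ hcor).trans (hrun.le_regret hθ k)
    have hent := hrun.integral_cumEntropy_le_of_mass hT k
    have hD : 0 ≤ ∑ t ∈ Finset.range T, c t :=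
      Finset.sum_nonneg fun t ht => hcor.corruption_nonneg t (Finset.mem_range.1 ht)
    have hup : regret μ θ T ℓ ϑ ≤ Real.log N +
        3 * √(Real.exp 1 / 2 * (capacity θ * Real.log (Real.exp 1 * T)) *
          (1 + Real.log ((N : ℝ) * T) * ∑ t ∈ Finset.range T,
            ∫ ω, (1 - (runState θ (exp4Gamma θ T) ℓ O t ω).prob k) ∂μ)) := by
      refine hreg.trans ?_
      rw [mul_assoc (Real.exp 1 / 2)]
      gcongr
    have h := regret_le_of_self_bounding (by positivity) hL hcor.gap_pos hD hlog.le hup hlow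
    rwa [← mul_assoc 2] at h
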